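/- Let $K$ be an algebraically closed field of characteristic $0$, let $r \ge 2$ be an integer, and let $C \subset \mathbb{P}^{2r-1} = \mathbb{P}^{2r-1}_K$ be a rational normal curve of degree $r$, that is, the image of $\mathbb{P}^1$ under the Veronese embedding $v_r : \mathbb{P}^1 \to \mathbb{P}^r$ followed by a linear embedding $\mathbb{P}^r \hookrightarrow \mathbb{P}^{2r-1}$. A double structure on $C$ is a closed subscheme $X \subset \mathbb{P}^{2r-1}$ whose ideal sheaf satisfies $\mathcal{I}_C^2 \subseteq \mathcal{I}_X \subseteq \mathcal{I}_C$ and such that $\mathcal{I}_X/\mathcal{I}_C^2$ is the kernel of a surjective morphism $\mathcal{I}_C/\mathcal{I}_C^2 \to \mathcal{L}$ onto a line bundle $\mathcal{L}$ on $C$. It is non-degenerate if it is contained in no hyperplane, and it has arithmetic genus $g$ if its Hilbert polynomial has the form $P_X(t) = dt + 1 - g$ for some integer $d$. Then, up to automorphisms of $\mathbb{P}^{2r-1}$, there is exactly one non-degenerate double structure on $C$ of arithmetic genus $1$: such a double structure exists, and for any two such double structures $X, Y$ on $C$ there is a projective linear transformation $g \in \mathrm{PGL}_{2r}(K)$ with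 $g(X) = Y$. -/

import Mathlib

attribute [local instance] MvPolynomial.gradedAlgebra

/-- The homogeneous coordinate ring `K[x_0, …, x_n]` of `ℙⁿ`. -/
abbrev CoordRing (K : Type*) [Field K] (n : ℕ) : Type _ :=
  MvPolynomial (Fin (n + 1)) K

/-- A closed subscheme of `ℙⁿ = Proj K[x_0, …, x_n]`, given by its saturated homogeneous ideal
`I_X = ⨁_j H⁰(ℙⁿ, 𝓘_X(j))`: a form that lies in the ideal after inverting each one
of the coordinates lies in the ideal. -/
structure ClosedSubschemeP (K : Type*) [Field K] (n : ℕ) where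
  /-- the saturated homogeneous ideal `I_X` -/
  ideal : Ideal (CoordRing K n)
  homogeneous : ideal.IsHomogeneous (MvPolynomial.homogeneousSubmodule (Fin (n + 1)) K)
  saturated : ∀ f : CoordRing K n,
    (∀ i, ∃ k : ℕ, MvPolynomial.X i ^ k * f ∈ ideal) → f ∈ ideal

/-- The coordinate ring `Γ(D₊(x_i), 𝒪)` of the `i`-th standard affine chart of `ℙⁿ`. -/
abbrev ChartRing (K : Type*) [Field K] (n : ℕ) (i : Fin (n + 1)) : Type _ :=
  HomogeneousLocalization.Away (MvPolynomial.homogeneousSubmodule (Fin (n + 1)) K)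
    (MvPolynomial.X i)

/-- The sections `Γ(D₊(x_i), 𝓘_X)` of the ideal sheaf of `X` over the `i`-th standard chart:
the fractions of degree `0` in the localization of `I_X` at `x_i`. -/
noncomputable def ClosedSubschemeP.chartIdeal {K : Type*} [Field K] {n : ℕ}
    (X : ClosedSubschemeP K n) (i : Fin (n + 1)) : Ideal (ChartRing K n i) :=
  (X.ideal.map (algebraMap (CoordRing K n)
      (Localization.Away (MvPolynomial.X i : CoordRing K n)))).comap
    (algebraMap (ChartRing K n i) (Localization.Away (MvPolynomial.X i : CoordRing K n)))

/-- For ideals `J ⊆ I` of a ring `A` with `I² ⊆ J`: the submodule `J / I²` of the conormal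
module `I / I²`, over `A / I`. -/
def conormalSubmodule {A : Type*} [CommRing A] (I J : Ideal A) :
    Submodule (A ⧸ I) I.Cotangent :=
  Submodule.span (A ⧸ I) (I.toCotangent '' {x : I | (x : A) ∈ J})

/-- `X` is a double structure (doubling) on `C`: `𝓘_C² ⊆ 𝓘_X ⊆ 𝓘_C`, and `𝓘_X / 𝓘_C²` is the
kernel of a surjection of the conormal sheaf `𝓘_C / 𝓘_C²` onto a line bundle on `C`, that is, the
quotient of `𝓘_C / 𝓘_C²` by `𝓘_X / 𝓘_C²` is an invertible `𝒪_C`-module. Invertibility is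
tested on the standard affine charts, which cover `ℙⁿ`. -/
def IsDoubleStructure {K : Type*} [Field K] {n : ℕ} (C X : ClosedSubschemeP K n) : Prop :=
  C.ideal ^ 2 ≤ X.ideal ∧ X.ideal ≤ C.ideal ∧
    ∀ i : Fin (n + 1),
      Module.Invertible (ChartRing K n i ⧸ C.chartIdeal i)
        ((C.chartIdeal i).Cotangent ⧸ conormalSubmodule (C.chartIdeal i) (X.chartIdeal i))

/-- The Veronese embedding of degree `r` followed by the linear map `φ`, as the tuple of binary
forms `(∑_j φ_{ij} t^{r-j} u^j)_i`; here `t` is `X 0`, `u` is `X 1`, and `(φ_{ij})` is the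
matrix of `φ`. -/
noncomputable def veroneseForms {K : Type*} [Field K] {n r : ℕ}
    (φ : (Fin (r + 1) → K) →ₗ[K] (Fin (n + 1) → K)) (i : Fin (n + 1)) :
    MvPolynomial (Fin 2) K :=
  ∑ j : Fin (r + 1), MvPolynomial.C (φ (Pi.single j 1) i) *
    (MvPolynomial.X 0 ^ (r - (j : ℕ)) * MvPolynomial.X 1 ^ (j : ℕ))

/-- `C ⊆ ℙⁿ` is a rational normal curve of degree `r`: the image of the Veronese embedding
`ℙ¹ → ℙʳ` followed by a linear embedding `ℙʳ → ℙⁿ`. The ideal of the image consists of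
the polynomials that vanish identically on the parametrization. -/
def IsRationalNormalCurve {K : Type*} [Field K] {n : ℕ} (r : ℕ)
    (C : ClosedSubschemeP K n) : Prop :=
  ∃ φ : (Fin (r + 1) → K) →ₗ[K] (Fin (n + 1) → K), Function.Injective φ ∧
    C.ideal = RingHom.ker (MvPolynomial.aeval (veroneseForms φ) :
      CoordRing K n →ₐ[K] MvPolynomial (Fin 2) K)

/-- The Hilbert function `h_X(j) = dim_K (R / I_X)_j`. -/
noncomputable def ClosedSubschemeP.hilbertFunction {K : Type*} [Field K] {n : ℕ}
    (X : ClosedSubschemeP K n) (j : ℕ) : ℕ :=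
  Module.finrank K ((MvPolynomial.homogeneousSubmodule (Fin (n + 1)) K j).map
    (Ideal.Quotient.mkₐ K X.ideal).toLinearMap)

/-- `P` is the Hilbert polynomial of `X`: `P(j) = h_X(j)` for all large `j`. -/
def ClosedSubschemeP.IsHilbertPolynomial {K : Type*} [Field K] {n : ℕ}
    (X : ClosedSubschemeP K n) (P : Polynomial ℚ) : Prop :=
  ∃ j₀ : ℕ, ∀ j : ℕ, j₀ ≤ j → P.eval (j : ℚ) = (X.hilbertFunction j : ℚ)

/-- `X` has a Hilbert polynomial of the form `d t + 1 - g`, where `g` is the arithmetic genus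
(and `d` the degree). -/
def ClosedSubschemeP.HasArithmeticGenus {K : Type*} [Field K] {n : ℕ}
    (X : ClosedSubschemeP K n) (g : ℤ) : Prop :=
  ∃ d : ℤ, X.IsHilbertPolynomial
    (Polynomial.C (d : ℚ) * Polynomial.X + Polynomial.C (1 - (g : ℚ)))

/-- `X` is non-degenerate: it is contained in no hyperplane. -/
def ClosedSubschemeP.IsNondegenerate {K : Type*} [Field K] {n : ℕ}
    (X : ClosedSubschemeP K n) : Prop :=
  ∀ l : CoordRing K n, l.IsHomogeneous 1 → l ∈ X.ideal → l = 0

/-- Composition `f ↦ f ∘ g` of a polynomial with an invertible linear map of `K^{n+1}`. -/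
noncomputable def linearSubst {K : Type*} [Field K] {n : ℕ} (g : GL (Fin (n + 1)) K) :
    CoordRing K n →ₐ[K] CoordRing K n :=
  MvPolynomial.aeval fun i => ∑ j : Fin (n + 1),
    MvPolynomial.C ((g : Matrix (Fin (n + 1)) (Fin (n + 1)) K) i j) * MvPolynomial.X j

/-- Some automorphism `g` of `ℙⁿ` (an element of `PGL_{n+1}(K)`, represented by an invertible
matrix) carries `X` to `Y`: the ideal of `Y = g(X)` consists of the `f` with `f ∘ g ∈ I_X`. -/
def ProjectivelyEquivalent {K : Type*} [Field K] {n : ℕ} (X Y : ClosedSubschemeP K n) : Prop :=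
  ∃ g : GL (Fin (n + 1)) K, Y.ideal = X.ideal.comap (linearSubst g)

/-! Write `r = m + 2` and let `x_i ↦ F_i(t, u)` parametrize `C`. A double structure is the kernel of
a graded map `ψ` from the ideal of `C` to `K[t, u]` that is linear over restriction to `C`; this is
the surjection of the conormal sheaf onto a line bundle, which on the projective line is some
`𝒪(e)`. The Hilbert function in large degree `d` counts binary forms of degree `r d` and of degree
`r d + e`, so the Hilbert polynomial is `2 r t + 2 + e`, and genus one means `e = -2`.

The heart is `IsConormalMap.exists_firstOrder`: every `ψ` of this degree is `f ↦` the `ε`-part of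
`f(F + ε G)` for some binary forms `G_i` of degree `r - 2`. Choose linear forms `ℓ_j` restricting to
`t^{r-j} u^j`. A conormal map is determined by its values on the linear forms vanishing on `C` and
on the quadrics `ℓ_i ℓ_{i+2} - ℓ_{i+1}²` (`IsConormalMap.eq_zero`). On the quadrics, finding `G`
means solving `t² p_{i+2} - 2 t u p_{i+1} + u² p_i = β_i` for forms `p_j` of degree `m`. This linear
system has `(m+3)(m+1)` unknown coefficients and as many equations, and it is injective because `m +
2 ≠ 0` in `K`, so it is solvable.

Uniqueness is then linear algebra. Non-degeneracy says that the `2 r` pairs `(F_i, G_i)` are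
linearly independent. They lie in the space of pairs of forms of degrees `r` and `r - 2`, of
dimension `(r + 1) + (r - 1) = 2 r`, so they are a basis, and the matrix between two such bases is
the required automorphism. Conversely, any `G` completing `F` to such a basis gives a double
structure, the kernel of `firstOrder F G`. -/

open MvPolynomial

/-! ### Homogeneous components of products and substitutions -/

section GradedPolynomials

variable {K σ : Type*} [Field K]

lemma homogeneousComponent_mul_of_isHomogeneous {G : MvPolynomial σ K} {γ : ℕ}
    (hG : G.IsHomogeneous γ) (h : MvPolynomial σ K) (k : ℕ) :
    homogeneousComponent (γ + k) (G * h) = G * homogeneousComponent k h := by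
  conv_lhs => rw [← sum_homogeneousComponent h, Finset.mul_sum, map_sum]
  have key : ∀ i, homogeneousComponent (γ + k) (G * homogeneousComponent i h)
      = if i = k then G * homogeneousComponent k h else 0 := by
    intro i
    rw [homogeneousComponent_of_mem (hG.mul (homogeneousComponent_isHomogeneous i h))]
    split_ifs with h1 h2 h2
    · rw [h2]
    · omega
    · omega
    · rfl
  simp only [key, Finset.sum_ite_eq', Finset.mem_range]
  split_ifs with h1
  · rfl
  · rw [homogeneousComponent_eq_zero _ _ (by omega), mul_zero]

lemma homogeneousComponent_mul_of_lt {G : MvPolynomial σ K} {γ : ℕ}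
    (hG : G.IsHomogeneous γ) (h : MvPolynomial σ K) {k : ℕ} (hk : k < γ) :
    homogeneousComponent k (G * h) = 0 := by
  conv_lhs => rw [← sum_homogeneousComponent h, Finset.mul_sum, map_sum]
  refine Finset.sum_eq_zero fun i _ => ?_
  rw [homogeneousComponent_of_mem (hG.mul (homogeneousComponent_isHomogeneous i h)), if_neg]
  omega

lemma isHomogeneous_of_mul_left {G h : MvPolynomial σ K} {γ k : ℕ} (hG : G.IsHomogeneous γ)
    (hG0 : G ≠ 0) (hGh : (G * h).IsHomogeneous (γ + k)) : h.IsHomogeneous k := by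
  have h1 := homogeneousComponent_mul_of_isHomogeneous hG h k
  rw [homogeneousComponent_eq_self hGh] at h1
  rw [mul_left_cancel₀ hG0 h1]
  exact homogeneousComponent_isHomogeneous _ _

lemma eq_zero_of_isHomogeneous_mul_of_lt {G h : MvPolynomial σ K} {γ k : ℕ}
    (hG : G.IsHomogeneous γ)
    (hG0 : G ≠ 0) (hGh : (G * h).IsHomogeneous k) (hk : k < γ) : h = 0 := by
  have h1 := homogeneousComponent_mul_of_lt hG h hk
  rw [homogeneousComponent_eq_self hGh] at h1
  exact (mul_eq_zero.mp h1).resolve_left hG0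

lemma homogeneousComponent_aeval {τ : Type*} {F : τ → MvPolynomial σ K} {r : ℕ} (hr : r ≠ 0)
    (hF : ∀ i, (F i).IsHomogeneous r) (f : MvPolynomial τ K) (d : ℕ) :
    homogeneousComponent (r * d) (aeval F f) = aeval F (homogeneousComponent d f) := by
  conv_lhs => rw [← sum_homogeneousComponent f, map_sum, map_sum]
  have key : ∀ i, homogeneousComponent (r * d) (aeval F (homogeneousComponent i f))
      = if i = d then aeval F (homogeneousComponent d f) else 0 := by
    intro i
    rw [homogeneousComponent_of_mem ((homogeneousComponent_isHomogeneous i f).aeval F hF)]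
    by_cases h : i = d
    · subst h; simp
    · rw [if_neg h, if_neg]
      exact fun h' => h (Nat.eq_of_mul_eq_mul_left (Nat.pos_of_ne_zero hr) h').symm
  simp only [key, Finset.sum_ite_eq', Finset.mem_range]
  split_ifs with h1
  · rfl
  · rw [homogeneousComponent_eq_zero _ _ (by omega), map_zero]

end GradedPolynomials

/-! ### Linear algebra of binary forms -/

section BinaryForms

variable {K : Type*} [Field K]

lemma isHomogeneous_X_pow_mul_X_pow (a b : ℕ) :
    (X 0 ^ a * X 1 ^ b : MvPolynomial (Fin 2) K).IsHomogeneous (a + b) :=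
  (isHomogeneous_X_pow 0 a).mul (isHomogeneous_X_pow 1 b)

lemma X_pow_mul_X_pow_eq_monomial (a b : ℕ) :
    (X 0 ^ a * X 1 ^ b : MvPolynomial (Fin 2) K)
      = monomial (Finsupp.single 0 a + Finsupp.single 1 b) 1 := by
  rw [X_pow_eq_monomial, X_pow_eq_monomial, monomial_mul, one_mul]

/-- Binary forms of degree `d` are spanned by the monomials of degree `d`. -/
lemma binaryForms_le {d : ℕ} (N : Submodule K (MvPolynomial (Fin 2) K))
    (h : ∀ a b, a + b = d → X 0 ^ a * X 1 ^ b ∈ N) : homogeneousSubmodule (Fin 2) K d ≤ N := by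
  intro f hf
  rw [f.as_sum]
  refine Submodule.sum_mem _ fun s hs => ?_
  have hd : s.degree = d := by
    rw [Finsupp.degree_eq_weight_one]
    exact (mem_homogeneousSubmodule d f).1 hf (mem_support_iff.1 hs)
  have : monomial s (coeff s f) = coeff s f • (X 0 ^ s 0 * X 1 ^ s 1 : MvPolynomial (Fin 2) K) := by
    have hs' : s = Finsupp.single 0 (s 0) + Finsupp.single 1 (s 1) := by
      refine Finsupp.ext fun i => ?_
      fin_cases i <;> simp
    rw [X_pow_mul_X_pow_eq_monomial, smul_monomial, smul_eq_mul, mul_one, ← hs']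
  rw [this]
  refine N.smul_mem _ (h _ _ ?_)
  rw [← hd]
  simp [Finsupp.degree_eq_sum]

/-- The binary form `∑ c_j t^{d-j} u^j`. -/
noncomputable def binaryForm (d : ℕ) : (Fin (d + 1) → K) →ₗ[K] MvPolynomial (Fin 2) K :=
  Fintype.linearCombination K fun j : Fin (d + 1) => X 0 ^ (d - (j : ℕ)) * X 1 ^ (j : ℕ)

lemma coeff_binaryForm (d : ℕ) (c : Fin (d + 1) → K) (j : Fin (d + 1)) :
    coeff (Finsupp.single 0 (d - (j : ℕ)) + Finsupp.single 1 (j : ℕ)) (binaryForm d c) = c j := by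
  simp only [binaryForm, Fintype.linearCombination_apply, coeff_sum, coeff_smul,
    X_pow_mul_X_pow_eq_monomial, coeff_monomial]
  rw [Finset.sum_eq_single j]
  · simp
  · intro b _ hb
    rw [if_neg, smul_zero]
    intro h
    apply hb
    have := DFunLike.congr_fun h 1
    simp at this
    exact Fin.ext this
  · simp

lemma binaryForm_injective (d : ℕ) : Function.Injective (binaryForm (K := K) d) := by
  intro c c' h
  funext j
  rw [← coeff_binaryForm d c j, h, coeff_binaryForm]

lemma range_binaryForm (d : ℕ) :
    LinearMap.range (binaryForm (K := K) d) = homogeneousSubmodule (Fin 2) K d := by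
  apply le_antisymm
  · rintro _ ⟨c, rfl⟩
    rw [binaryForm, Fintype.linearCombination_apply]
    refine Submodule.sum_mem _ fun j _ => Submodule.smul_mem _ _ ?_
    have := isHomogeneous_X_pow_mul_X_pow (K := K) (d - j) j
    rwa [Nat.sub_add_cancel (by omega)] at this
  · refine binaryForms_le _ fun a b hab => ⟨Pi.single ⟨b, by omega⟩ 1, ?_⟩
    rw [binaryForm, Fintype.linearCombination_apply_single, one_smul]
    congr
    simp; omega

/-- Binary forms of degree `d` in coordinates. -/
noncomputable def binaryFormEquiv (d : ℕ) :
    (Fin (d + 1) → K) ≃ₗ[K] homogeneousSubmodule (Fin 2) K d :=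
  (LinearEquiv.ofInjective _ (binaryForm_injective d)).trans
    (LinearEquiv.ofEq _ _ (range_binaryForm d))

lemma finrank_binaryForms (d : ℕ) :
    Module.finrank K (homogeneousSubmodule (Fin 2) K d) = d + 1 := by
  rw [← (binaryFormEquiv d).finrank_eq]; simp

instance binaryForms_finite (d : ℕ) :
    Module.Finite K (homogeneousSubmodule (Fin 2) K d) :=
  Module.Finite.equiv (binaryFormEquiv d)

/-- Products of binary forms of degrees `a` and `b` span the forms of degree `a + b`. -/
lemma binaryForms_add_le (a b : ℕ) (N : Submodule K (MvPolynomial (Fin 2) K))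
    (h : ∀ f g : MvPolynomial (Fin 2) K, f.IsHomogeneous a → g.IsHomogeneous b → f * g ∈ N) :
    homogeneousSubmodule (Fin 2) K (a + b) ≤ N := by
  refine binaryForms_le N fun p q hpq => ?_
  -- Split off a monomial of degree `a`, taking as many factors `X 0` as are available.
  have e : (X 0 ^ p * X 1 ^ q : MvPolynomial (Fin 2) K)
      = (X 0 ^ min p a * X 1 ^ (a - min p a)) * (X 0 ^ (p - min p a) * X 1 ^ (q - (a - min p a))) := by
    rw [mul_mul_mul_comm, ← pow_add, ← pow_add]
    congr 2 <;> omega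
  rw [e]
  refine h _ _ ?_ ?_
  · convert isHomogeneous_X_pow_mul_X_pow (K := K) _ _ using 1; omega
  · convert isHomogeneous_X_pow_mul_X_pow (K := K) _ _ using 1; omega

/-- In a monomial of degree at least `2 N`, one of the two exponents is at least `N`. -/
lemma binaryForms_le_of_X_pow_mem {N k : ℕ} (hk : 2 * N ≤ k)
    {𝔟 : Ideal (MvPolynomial (Fin 2) K)} (h : ∀ i, X i ^ N ∈ 𝔟) :
    homogeneousSubmodule (Fin 2) K k ≤ 𝔟.restrictScalars K := by
  refine binaryForms_le _ fun a b hab => ?_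
  rw [Submodule.restrictScalars_mem]
  by_cases ha : N ≤ a
  · rw [← Nat.sub_add_cancel ha, pow_add, mul_right_comm]
    exact 𝔟.mul_mem_left _ (h 0)
  · rw [← Nat.sub_add_cancel (show N ≤ b by omega), pow_add, ← mul_assoc]
    exact 𝔟.mul_mem_left _ (h 1)

lemma aeval_mul_of_isHomogeneous {σ A : Type*} [CommRing A] [Algebra K A] {f : MvPolynomial σ K}
    {d : ℕ} (hf : f.IsHomogeneous d) (c : A) (y : σ → A) :
    aeval (fun i => c * y i) f = c ^ d * aeval y f := by
  rw [aeval_def, aeval_def, eval₂_eq, eval₂_eq, Finset.mul_sum]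
  refine Finset.sum_congr rfl fun s hs => ?_
  have hd : s.degree = d := by
    rw [Finsupp.degree_eq_weight_one]
    exact hf (mem_support_iff.1 hs)
  simp only [mul_pow, Finset.prod_mul_distrib]
  rw [Finset.prod_pow_eq_pow_sum, ← hd, Finsupp.degree_apply]
  ring

end BinaryForms

/-! ### The twisted second difference operator -/

section SecondDifferences

variable {K : Type*} [Field K]

lemma not_X_zero_dvd_X_one_pow (b : ℕ) : ¬ (X 0 : MvPolynomial (Fin 2) K) ∣ X 1 ^ b := by
  intro h
  have := (X_prime : Prime (X 0 : MvPolynomial (Fin 2) K)).dvd_of_dvd_pow h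
  rw [X_dvd_X] at this
  simp at this

lemma not_X_one_dvd_X_zero_pow (b : ℕ) : ¬ (X 1 : MvPolynomial (Fin 2) K) ∣ X 0 ^ b := by
  intro h
  have := (X_prime : Prime (X 1 : MvPolynomial (Fin 2) K)).dvd_of_dvd_pow h
  rw [X_dvd_X] at this
  simp at this

lemma X_zero_pow_dvd_of_dvd_mul {a b : ℕ} {f : MvPolynomial (Fin 2) K}
    (h : X 0 ^ a ∣ X 1 ^ b * f) : X 0 ^ a ∣ f :=
  (X_prime : Prime (X 0 : MvPolynomial (Fin 2) K)).pow_dvd_of_dvd_mul_left a (not_X_zero_dvd_X_one_pow b) h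

lemma X_one_pow_dvd_of_dvd_mul {a b : ℕ} {f : MvPolynomial (Fin 2) K}
    (h : X 1 ^ a ∣ X 0 ^ b * f) : X 1 ^ a ∣ f :=
  (X_prime : Prime (X 1 : MvPolynomial (Fin 2) K)).pow_dvd_of_dvd_mul_left a (not_X_one_dvd_X_zero_pow b) h

/-- The twisted second difference operator has no kernel in low degree. -/
lemma eq_zero_of_secondDifference_eq_zero [CharZero K] {m : ℕ}
    (p : ℕ → MvPolynomial (Fin 2) K) (hp : ∀ i, (p i).IsHomogeneous m)
    (h : ∀ i ≤ m, X 0 ^ 2 * p (i + 2) - 2 * X 0 * X 1 * p (i + 1) + X 1 ^ 2 * p i = 0) :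
    ∀ i ≤ m + 2, p i = 0 := by
  -- The operator factors through this first difference: the hypothesis says `t d_{i+1} = u d_i`.
  -- Iterating gives `t^{m+1} d_{m+1} = u^{m+1} d_0`, so `d_0`, of degree `m + 1`, is `c t^{m+1}`.
  set d : ℕ → MvPolynomial (Fin 2) K := fun i => X 0 * p (i + 1) - X 1 * p i with hd
  have hstep : ∀ i ≤ m, X 0 * d (i + 1) = X 1 * d i := by
    intro i hi
    have := h i hi
    simp only [hd]
    linear_combination this
  have hpow : ∀ i ≤ m + 1, X 0 ^ i * d i = X 1 ^ i * d 0 := by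
    intro i
    induction i with
    | zero => simp
    | succ i ih =>
      intro hi
      linear_combination X 0 ^ i * hstep i (by omega) + X 1 * ih (by omega)
  have hd0 : (d 0).IsHomogeneous (m + 1) := by
    rw [add_comm]
    exact ((isHomogeneous_X K 0).mul (hp 1)).sub ((isHomogeneous_X K 1).mul (hp 0))
  obtain ⟨e, he⟩ : X 0 ^ (m + 1) ∣ d 0 :=
    X_zero_pow_dvd_of_dvd_mul (b := m + 1) ⟨d (m + 1), (hpow (m + 1) le_rfl).symm⟩
  have he0 : e.IsHomogeneous 0 := by
    refine isHomogeneous_of_mul_left (isHomogeneous_X_pow (R := K) (0 : Fin 2) (m + 1))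
      (pow_ne_zero _ (X_ne_zero _)) ?_
    rw [← he]; exact hd0
  obtain ⟨c, rfl⟩ : ∃ c, e = C c := ⟨_, totalDegree_eq_zero_iff_eq_C.1
    ((totalDegree_zero_iff_isHomogeneous _).2 he0)⟩
  have htel : ∀ i ≤ m + 1, X 0 ^ (i + 1) * p (i + 1)
      = X 1 ^ (i + 1) * p 0 + ((i + 1 : ℕ) : MvPolynomial (Fin 2) K) * C c * X 0 ^ (m + 1) * X 1 ^ i := by
    intro i
    induction i with
    | zero =>
      intro _
      simp only [hd] at he
      push_cast
      linear_combination he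
    | succ i ih =>
      intro hi
      have h1 := ih (by omega)
      have h2 := hpow (i + 1) hi
      rw [he] at h2
      simp only [hd] at h2
      push_cast at h1 ⊢
      linear_combination h2 + X 1 * h1
  have hlast := htel (m + 1) le_rfl
  -- The last telescoped identity shows that `t^{m+2}` divides a form of degree only `m + 1`, which
  -- must therefore vanish.
  have hdvd : X 0 ^ (m + 2) ∣ X 1 * p 0 + (((m + 2 : ℕ) : MvPolynomial (Fin 2) K) * C c * X 0 ^ (m + 1)) := by
    refine X_zero_pow_dvd_of_dvd_mul (b := m + 1) ⟨p (m + 2), ?_⟩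
    push_cast at hlast ⊢
    linear_combination -hlast
  have hzero : X 1 * p 0 + (((m + 2 : ℕ) : MvPolynomial (Fin 2) K) * C c * X 0 ^ (m + 1)) = 0 := by
    obtain ⟨q, hq⟩ := hdvd
    rw [hq, eq_zero_of_isHomogeneous_mul_of_lt (isHomogeneous_X_pow (R := K) (0 : Fin 2) (m + 2))
      (pow_ne_zero _ (X_ne_zero _)) (k := m + 1) (h := q) ?_ (by omega), mul_zero]
    rw [← hq]
    refine IsHomogeneous.add ?_ ?_
    · rw [add_comm]; exact (isHomogeneous_X K 1).mul (hp 0)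
    · have : (((m + 2 : ℕ) : MvPolynomial (Fin 2) K) * C c) = C (((m + 2 : ℕ) : K) * c) := by
        rw [C_mul, map_natCast]
      rw [this]
      exact (isHomogeneous_X_pow _ _).C_mul _
  -- At the point `(1, 0)` only `(m + 2) c` survives; here characteristic zero is essential.
  have hc : c = 0 := by
    have := congrArg (eval ![1, 0]) hzero
    simp only [map_add, map_mul, map_pow, map_natCast, eval_X, eval_C, map_zero] at this
    simp at this
    rcases this with h | h
    · exact absurd h (by exact_mod_cast (by omega : (m + 2 : ℕ) ≠ 0))
    · exact h
  subst hc
  have hp0 : p 0 = 0 := by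
    simp only [map_zero, mul_zero, zero_mul, add_zero] at hzero
    exact (mul_eq_zero.1 hzero).resolve_left (X_ne_zero _)
  intro i hi
  rcases i with _ | i
  · exact hp0
  · have := htel i (by omega)
    simp only [hp0, map_zero, mul_zero, zero_mul, add_zero] at this
    exact (mul_eq_zero.1 this).resolve_left (pow_ne_zero _ (X_ne_zero _))

/-- The twisted second difference operator is surjective. -/
lemma exists_secondDifference_eq [CharZero K] {m : ℕ}
    (β : ℕ → MvPolynomial (Fin 2) K) (hβ : ∀ i ≤ m, (β i).IsHomogeneous (m + 2)) :
    ∃ p : ℕ → MvPolynomial (Fin 2) K, (∀ i, (p i).IsHomogeneous m) ∧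
      ∀ i ≤ m, X 0 ^ 2 * p (i + 2) - 2 * X 0 * X 1 * p (i + 1) + X 1 ^ 2 * p i = β i := by
  let V := homogeneousSubmodule (Fin 2) K m
  let W := homogeneousSubmodule (Fin 2) K (m + 2)
  let ext : (Fin (m + 3) → V) → ℕ → MvPolynomial (Fin 2) K :=
    fun p i => if hi : i < m + 3 then (p ⟨i, hi⟩ : MvPolynomial (Fin 2) K) else 0
  have hext : ∀ p i, (ext p i).IsHomogeneous m := by
    intro p i
    simp only [ext]
    split_ifs with hi
    · exact (p ⟨i, hi⟩).2
    · exact isHomogeneous_zero _ _ _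
  let A : (Fin (m + 3) → V) →ₗ[K] (Fin (m + 1) → W) :=
    { toFun := fun p i => ⟨X 0 ^ 2 * ext p (i + 2) - 2 * X 0 * X 1 * ext p (i + 1)
          + X 1 ^ 2 * ext p i, by
          have h2 : (2 : MvPolynomial (Fin 2) K) = C 2 := (map_ofNat C 2).symm
          have e : m + 2 = 2 + m := add_comm _ _
          rw [mem_homogeneousSubmodule, e]
          refine ((isHomogeneous_X_pow _ _).mul (hext _ _)).sub ?_ |>.add
            ((isHomogeneous_X_pow _ _).mul (hext _ _))
          refine IsHomogeneous.mul ?_ (hext _ _)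
          rw [h2, mul_assoc]
          exact ((isHomogeneous_X _ _).mul (isHomogeneous_X _ _)).C_mul _⟩
      map_add' := by
        intro p q
        funext i
        apply Subtype.ext
        have h : ∀ i, ext (p + q) i = ext p i + ext q i := by
          intro i
          by_cases hi : i < m + 3 <;> simp [ext, hi]
        simp only [h, Pi.add_apply, Submodule.coe_add]
        ring
      map_smul' := by
        intro c p
        funext i
        apply Subtype.ext
        have h : ∀ i, ext (c • p) i = C c * ext p i := by
          intro i
          by_cases hi : i < m + 3 <;> simp [ext, hi, ← MvPolynomial.smul_eq_C_mul]
        simp only [h, Pi.smul_apply, Submodule.coe_smul, RingHom.id_apply,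
          MvPolynomial.smul_eq_C_mul]
        ring }
  have hinj : Function.Injective A := by
    rw [← LinearMap.ker_eq_bot, LinearMap.ker_eq_bot']
    intro p hp
    have := eq_zero_of_secondDifference_eq_zero (ext p) (hext p) (fun i hi => by
      have := congrArg Subtype.val (congrFun hp ⟨i, by omega⟩)
      exact this)
    funext i
    apply Subtype.ext
    have h1 := this i (by omega)
    simpa [ext] using h1
  -- Source and target both have dimension `(m + 3)(m + 1)`, so injectivity suffices.
  have hsurj : Function.Surjective A := by
    refine (LinearMap.injective_iff_surjective_of_finrank_eq_finrank ?_).1 hinj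
    rw [Module.finrank_pi_fintype, Module.finrank_pi_fintype]
    simp only [V, W, finrank_binaryForms, Finset.sum_const, Finset.card_univ, Fintype.card_fin,
      smul_eq_mul]
    ring
  obtain ⟨p, hp⟩ := hsurj fun i => ⟨β i, hβ i (by omega)⟩
  exact ⟨ext p, hext p, fun i hi => congrArg Subtype.val (congrFun hp ⟨i, by omega⟩)⟩

end SecondDifferences

/-! ### Conormal maps and the quadrics through the curve -/

section ConormalMaps

variable {K σ : Type*} [Field K]

/-- `ψ` restricts to a linear map from the kernel `I` of `aeval F : K[x] → K[t,u]` to `K[t,u]`;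
equivalently, it is a linear map out of the conormal module `I / I²`. -/
structure IsConormalMap (F : σ → MvPolynomial (Fin 2) K)
    (ψ : MvPolynomial σ K → MvPolynomial (Fin 2) K) : Prop where
  map_add : ∀ f g, aeval F f = 0 → aeval F g = 0 → ψ (f + g) = ψ f + ψ g
  map_mul : ∀ a f, aeval F f = 0 → ψ (a * f) = aeval F a * ψ f

/-- The first order thickening `x_i ↦ F_i + ε G_i` of a parametrization `x_i ↦ F_i`. -/
noncomputable def firstOrder (F G : σ → MvPolynomial (Fin 2) K) : MvPolynomial σ K →ₐ[K]
    TrivSqZeroExt (MvPolynomial (Fin 2) K) (MvPolynomial (Fin 2) K) :=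
  aeval fun i => TrivSqZeroExt.inl (F i) + TrivSqZeroExt.inr (G i)

variable {F G : σ → MvPolynomial (Fin 2) K} {ψ : MvPolynomial σ K → MvPolynomial (Fin 2) K}

lemma fst_firstOrder (f : MvPolynomial σ K) : (firstOrder F G f).fst = aeval F f := by
  have : (TrivSqZeroExt.fstHom K (MvPolynomial (Fin 2) K) (MvPolynomial (Fin 2) K)).comp
      (firstOrder F G) = aeval F := by
    ext i
    simp [firstOrder]
  exact DFunLike.congr_fun this f

lemma snd_firstOrder_mul (f g : MvPolynomial σ K) : (firstOrder F G (f * g)).snd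
    = aeval F f * (firstOrder F G g).snd + aeval F g * (firstOrder F G f).snd := by
  rw [map_mul, TrivSqZeroExt.snd_mul, fst_firstOrder, fst_firstOrder, op_smul_eq_smul,
    smul_eq_mul, smul_eq_mul]

lemma snd_firstOrder_X (i : σ) : (firstOrder F G (X i)).snd = G i := by
  simp [firstOrder]

lemma snd_firstOrder_add (f g : MvPolynomial σ K) : (firstOrder F G (f + g)).snd
    = (firstOrder F G f).snd + (firstOrder F G g).snd := by
  rw [map_add, TrivSqZeroExt.snd_add]

lemma snd_firstOrder_sub (f g : MvPolynomial σ K) : (firstOrder F G (f - g)).snd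
    = (firstOrder F G f).snd - (firstOrder F G g).snd := by
  rw [map_sub, TrivSqZeroExt.snd_sub]

lemma snd_firstOrder_smul (c : K) (f : MvPolynomial σ K) : (firstOrder F G (c • f)).snd
    = c • (firstOrder F G f).snd := by
  rw [map_smul, TrivSqZeroExt.snd_smul]

lemma isConormalMap_firstOrder : IsConormalMap F fun f => (firstOrder F G f).snd where
  map_add f g _ _ := snd_firstOrder_add f g
  map_mul a f hf := by simp only [snd_firstOrder_mul, hf, zero_mul, add_zero]

namespace IsConormalMap

lemma map_zero (h : IsConormalMap F ψ) : ψ 0 = 0 := by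
  simpa using h.map_mul 0 0 (_root_.map_zero _)

lemma map_neg (h : IsConormalMap F ψ) {f : MvPolynomial σ K} (hf : aeval F f = 0) :
    ψ (-f) = -ψ f := by
  simpa using h.map_mul (-1) f hf

lemma map_sub (h : IsConormalMap F ψ) {f g : MvPolynomial σ K} (hf : aeval F f = 0)
    (hg : aeval F g = 0) : ψ (f - g) = ψ f - ψ g := by
  rw [sub_eq_add_neg, h.map_add _ _ hf (by rw [_root_.map_neg, hg, neg_zero]), h.map_neg hg, sub_eq_add_neg]

lemma map_smul (h : IsConormalMap F ψ) (c : K) {f : MvPolynomial σ K} (hf : aeval F f = 0) :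
    ψ (c • f) = c • ψ f := by
  rw [MvPolynomial.smul_eq_C_mul, h.map_mul _ _ hf, aeval_C, MvPolynomial.smul_eq_C_mul]
  rfl

lemma sub {χ : MvPolynomial σ K → MvPolynomial (Fin 2) K} (h : IsConormalMap F ψ)
    (h' : IsConormalMap F χ) : IsConormalMap F fun f => ψ f - χ f where
  map_add f g hf hg := by rw [h.map_add f g hf hg, h'.map_add f g hf hg]; ring
  map_mul a f hf := by rw [h.map_mul a f hf, h'.map_mul a f hf]; ring

/-- The ideal of elements of the kernel killed by a conormal map. -/
def kerIdeal (h : IsConormalMap F ψ) : Ideal (MvPolynomial σ K) where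
  carrier := {f | aeval F f = 0 ∧ ψ f = 0}
  zero_mem' := ⟨_root_.map_zero _, h.map_zero⟩
  add_mem' := fun {f g} hf hg => ⟨by rw [_root_.map_add, hf.1, hg.1, add_zero],
    by rw [h.map_add f g hf.1 hg.1, hf.2, hg.2, add_zero]⟩
  smul_mem' := fun a f hf => ⟨by rw [smul_eq_mul, _root_.map_mul, hf.1, mul_zero],
    by rw [smul_eq_mul, h.map_mul a f hf.1, hf.2, mul_zero]⟩

end IsConormalMap

variable {m : ℕ} {ℓ : ℕ → MvPolynomial σ K}

/-- The minor `ℓ_i ℓ_{j+1} - ℓ_{i+1} ℓ_j`. -/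
noncomputable def minor (ℓ : ℕ → MvPolynomial σ K) (i j : ℕ) : MvPolynomial σ K :=
  ℓ i * ℓ (j + 1) - ℓ (i + 1) * ℓ j

lemma aeval_minor (hℓ : ∀ j ≤ m + 2, aeval F (ℓ j) = X 0 ^ (m + 2 - j) * X 1 ^ j) {i j : ℕ}
    (hi : i ≤ m + 1) (hj : j ≤ m + 1) : aeval F (minor ℓ i j) = 0 := by
  simp only [minor, map_sub, map_mul]
  rw [hℓ i (by omega), hℓ _ (by omega : j + 1 ≤ m + 2), hℓ _ (by omega : i + 1 ≤ m + 2),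
    hℓ j (by omega)]
  rw [show m + 2 - i = (m + 1 - i) + 1 by omega, show m + 2 - j = (m + 1 - j) + 1 by omega,
    show m + 2 - (i + 1) = m + 1 - i by omega, show m + 2 - (j + 1) = m + 1 - j by omega]
  ring

/-- This is `ψ` applied to the expansion of a 3 × 3 determinant with a repeated row, with one factor
`t` cancelled. -/
lemma IsConormalMap.minor_relation (h : IsConormalMap F ψ)
    (hℓ : ∀ j ≤ m + 2, aeval F (ℓ j) = X 0 ^ (m + 2 - j) * X 1 ^ j) {i j k : ℕ}
    (hi : i ≤ m + 1) (hj : j ≤ m + 1) (hk : k ≤ m + 1) :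
    X 0 ^ (m + 1 - k) * X 1 ^ k * ψ (minor ℓ i j) + X 0 ^ (m + 1 - i) * X 1 ^ i * ψ (minor ℓ j k)
      + X 0 ^ (m + 1 - j) * X 1 ^ j * ψ (minor ℓ k i) = 0 := by
  have e : ℓ k * minor ℓ i j + ℓ i * minor ℓ j k + ℓ j * minor ℓ k i = 0 := by
    simp only [minor]; ring
  have hmul : ∀ a {i j : ℕ}, i ≤ m + 1 → j ≤ m + 1 → aeval F (a * minor ℓ i j) = 0 := by
    intro a i j hi hj
    rw [_root_.map_mul, aeval_minor hℓ hi hj, mul_zero]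
  have e2 := congrArg ψ e
  rw [h.map_add _ _ (by rw [_root_.map_add, hmul _ hi hj, hmul _ hj hk, add_zero]) (hmul _ hk hi),
    h.map_add _ _ (hmul _ hi hj) (hmul _ hj hk), h.map_mul _ _ (aeval_minor hℓ hi hj),
    h.map_mul _ _ (aeval_minor hℓ hj hk), h.map_mul _ _ (aeval_minor hℓ hk hi), h.map_zero,
    hℓ i (by omega), hℓ j (by omega), hℓ k (by omega),
    show m + 2 - i = (m + 1 - i) + 1 by omega, show m + 2 - j = (m + 1 - j) + 1 by omega,
    show m + 2 - k = (m + 1 - k) + 1 by omega] at e2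
  refine (mul_eq_zero.1 (?_ : (X 0 : MvPolynomial (Fin 2) K) * _ = 0)).resolve_left
    (X_ne_zero (0 : Fin 2))
  rw [← e2]
  ring

/-- In the three-term relation, the index `k = 0` forces divisibility by `u^i` and `k = m + 1`
divisibility by `t^{m-i}`. The quotient is the right-hand side `β_i` of the second difference
equation. -/
lemma IsConormalMap.dvd_minor (h : IsConormalMap F ψ)
    (hℓ : ∀ j ≤ m + 2, aeval F (ℓ j) = X 0 ^ (m + 2 - j) * X 1 ^ j) {i : ℕ} (hi : i ≤ m) :
    X 0 ^ (m - i) * X 1 ^ i ∣ ψ (minor ℓ i (i + 1)) := by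
  have h0 := h.minor_relation hℓ (i := i) (j := i + 1) (k := 0) (by omega) (by omega) (by omega)
  have h1 := h.minor_relation hℓ (i := i) (j := i + 1) (k := m + 1) (by omega) (by omega) le_rfl
  obtain ⟨g, hg⟩ : X 1 ^ i ∣ ψ (minor ℓ i (i + 1)) := by
    refine X_one_pow_dvd_of_dvd_mul (b := m + 1) ⟨-(X 0 ^ (m + 1 - i) * ψ (minor ℓ (i + 1) 0)
      + X 0 ^ (m + 1 - (i + 1)) * X 1 * ψ (minor ℓ 0 i)), ?_⟩
    simp only [Nat.sub_zero, pow_zero, mul_one] at h0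
    linear_combination h0
  obtain ⟨g', hg'⟩ : X 0 ^ (m - i) ∣ ψ (minor ℓ i (i + 1)) := by
    refine X_zero_pow_dvd_of_dvd_mul (b := m + 1) ⟨-(X 0 * X 1 ^ i * ψ (minor ℓ (i + 1) (m + 1))
      + X 1 ^ (i + 1) * ψ (minor ℓ (m + 1) i)), ?_⟩
    simp only [Nat.sub_self, pow_zero, one_mul] at h1
    rw [show m + 1 - i = (m - i) + 1 by omega, show m + 1 - (i + 1) = m - i by omega] at h1
    linear_combination h1
  obtain ⟨q, rfl⟩ := X_zero_pow_dvd_of_dvd_mul (b := i) (f := g) ⟨g', by rw [← hg, hg']⟩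
  exact ⟨q, by rw [hg]; ring⟩

/-- A polynomial relation between `t^r` and `t^{r-1} u` is trivial. -/
lemma eq_zero_of_aeval_X_pow [IsAlgClosed K] (h : MvPolynomial (Fin 2) K)
    (h0 : aeval (![X 0 ^ (m + 2), X 0 ^ (m + 1) * X 1] : Fin 2 → MvPolynomial (Fin 2) K) h = 0) :
    h = 0 := by
  have key : X 0 * h = 0 := by
    refine MvPolynomial.funext fun x => ?_
    rw [map_mul, eval_X, _root_.map_zero]
    by_cases hx : x 0 = 0
    · rw [hx, zero_mul]
    -- Every point with `x 0 ≠ 0` is of the form `(t^{m+2}, t^{m+1} u)`: extract a root for `t`,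
    -- then solve for `u`.
    · obtain ⟨t, ht⟩ := IsAlgClosed.exists_pow_nat_eq (x 0) (show 0 < m + 2 by omega)
      have ht0 : t ≠ 0 := by
        rintro rfl
        exact hx (by rw [← ht]; simp)
      have h1 := congrArg (aeval ![t, x 1 / t ^ (m + 1)] : MvPolynomial (Fin 2) K →ₐ[K] K) h0
      rw [_root_.map_zero, comp_aeval_apply] at h1
      have h2 : eval x h = 0 := by
        rw [← aeval_eq_eval, ← h1]
        refine congrArg (fun y : Fin 2 → K => (aeval y : MvPolynomial (Fin 2) K →ₐ[K] K) h) ?_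
        funext i
        fin_cases i
        · simp [ht]
        · simp [mul_div_cancel₀, ht0]
      rw [h2, mul_zero]
  exact (mul_eq_zero.1 key).resolve_left (X_ne_zero _)

lemma aeval_linear_decomposition (hℓ : ∀ j ≤ m + 2, aeval F (ℓ j) = X 0 ^ (m + 2 - j) * X 1 ^ j)
    (hF : ∀ i, (F i).IsHomogeneous (m + 2)) (i : σ) :
    ∃ c : Fin (m + 3) → K, aeval F (X i - ∑ j : Fin (m + 3), c j • ℓ j) = 0 := by
  have := range_binaryForm (K := K) (m + 2)
  obtain ⟨c, hc⟩ : F i ∈ LinearMap.range (binaryForm (m + 2)) := by rw [this]; exact hF i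
  refine ⟨c, ?_⟩
  rw [map_sub, aeval_X, map_sum, sub_eq_zero, ← hc, binaryForm, Fintype.linearCombination_apply]
  refine Finset.sum_congr rfl fun j _ => ?_
  rw [_root_.map_smul, hℓ j (by omega)]

/-- A conormal map vanishes if it vanishes on the linear forms and the quadrics
`ℓ_i ℓ_{i+2} - ℓ_{i+1}²`. -/
theorem IsConormalMap.eq_zero [IsAlgClosed K] (h : IsConormalMap F ψ)
    (hF : ∀ i, (F i).IsHomogeneous (m + 2))
    (hℓ : ∀ j ≤ m + 2, aeval F (ℓ j) = X 0 ^ (m + 2 - j) * X 1 ^ j)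
    (hℓ1 : ∀ j, (ℓ j).IsHomogeneous 1)
    (h1 : ∀ f, aeval F f = 0 → f.IsHomogeneous 1 → ψ f = 0)
    (h2 : ∀ i ≤ m, ψ (minor ℓ i (i + 1)) = 0) :
    ∀ f, aeval F f = 0 → ψ f = 0 := by
  -- The three-term relation for `j`, `j + 1`, `0` reduces the minor with indices `0, j + 1` to the
  -- one with indices `0, j` and a consecutive one.
  have hmin : ∀ j ≤ m + 1, ψ (minor ℓ 0 j) = 0 := by
    intro j
    induction j with
    | zero => intro _; simp [minor, mul_comm, h.map_zero]
    | succ j ih =>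
      intro hj
      have h3 := h.minor_relation hℓ (i := j) (j := j + 1) (k := 0) (by omega) hj (by omega)
      rw [h2 j (by omega), ih (by omega), mul_zero, mul_zero, zero_add, add_zero] at h3
      have h4 := (mul_eq_zero.1 h3).resolve_left
        (mul_ne_zero (pow_ne_zero _ (X_ne_zero _)) (pow_ne_zero _ (X_ne_zero _)))
      have h5 : minor ℓ 0 (j + 1) = - minor ℓ (j + 1) 0 := by simp only [minor]; ring
      rw [h5, h.map_neg (aeval_minor hℓ hj (by omega)), h4, neg_zero]
  let T := h.kerIdeal
  have hq : ∀ j ≤ m + 1, ℓ 0 ^ j * ℓ (j + 1) - ℓ 1 ^ (j + 1) ∈ T := by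
    intro j
    induction j with
    | zero => intro _; simp
    | succ j ih =>
      intro hj
      have e : ℓ 0 ^ (j + 1) * ℓ (j + 1 + 1) - ℓ 1 ^ (j + 1 + 1)
          = ℓ 0 ^ j * minor ℓ 0 (j + 1) + ℓ 1 * (ℓ 0 ^ j * ℓ (j + 1) - ℓ 1 ^ (j + 1)) := by
        simp only [minor]; ring
      rw [e]
      exact T.add_mem (T.mul_mem_left _ ⟨aeval_minor hℓ (by omega) hj, hmin _ hj⟩)
        (T.mul_mem_left _ (ih (by omega)))
  -- Where `ℓ_0` is invertible, every polynomial becomes modulo `T` a polynomial in `ℓ_0` and `ℓ_1`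
  -- alone. For `f` vanishing on the curve that polynomial is zero, by `eq_zero_of_aeval_X_pow`, so
  -- `ψ` kills `ℓ_0^N f`, hence `f`.
  let P : MvPolynomial σ K → Prop := fun f =>
    ∃ (N : ℕ) (g : MvPolynomial (Fin 2) K), ℓ 0 ^ N * f - aeval ![ℓ 0, ℓ 1] g ∈ T
  have Padd : ∀ f g, P f → P g → P (f + g) := by
    rintro f g ⟨N, a, ha⟩ ⟨M, b, hb⟩
    refine ⟨N + M, X 0 ^ M * a + X 0 ^ N * b, ?_⟩
    have e : ℓ 0 ^ (N + M) * (f + g) - aeval ![ℓ 0, ℓ 1] (X 0 ^ M * a + X 0 ^ N * b)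
        = ℓ 0 ^ M * (ℓ 0 ^ N * f - aeval ![ℓ 0, ℓ 1] a)
          + ℓ 0 ^ N * (ℓ 0 ^ M * g - aeval ![ℓ 0, ℓ 1] b) := by
      simp; ring
    rw [e]
    exact T.add_mem (T.mul_mem_left _ ha) (T.mul_mem_left _ hb)
  have Pmul : ∀ f g, P f → P g → P (f * g) := by
    rintro f g ⟨N, a, ha⟩ ⟨M, b, hb⟩
    refine ⟨N + M, a * b, ?_⟩
    have e : ℓ 0 ^ (N + M) * (f * g) - aeval ![ℓ 0, ℓ 1] (a * b)
        = ℓ 0 ^ N * f * (ℓ 0 ^ M * g - aeval ![ℓ 0, ℓ 1] b)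
          + aeval ![ℓ 0, ℓ 1] b * (ℓ 0 ^ N * f - aeval ![ℓ 0, ℓ 1] a) := by
      rw [_root_.map_mul]; ring
    rw [e]
    exact T.add_mem (T.mul_mem_left _ hb) (T.mul_mem_left _ ha)
  have PC : ∀ c : K, P (C c) := fun c => ⟨0, C c, by simp [algebraMap_eq]⟩
  have PT : ∀ f ∈ T, P f := fun f hf => ⟨0, 0, by simpa using hf⟩
  have Pℓ : ∀ j ≤ m + 2, P (ℓ j) := by
    intro j hj
    rcases j with _ | j
    · exact ⟨0, X 0, by simp⟩
    · exact ⟨j, X 1 ^ (j + 1), by simpa using hq j (by omega)⟩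
  have PX : ∀ i, P (X i) := by
    intro i
    obtain ⟨c, hc⟩ := aeval_linear_decomposition hℓ hF i
    rw [← sub_add_cancel (X i) (∑ j : Fin (m + 3), c j • ℓ j)]
    refine Padd _ _ (PT _ ⟨hc, h1 _ hc ?_⟩) ?_
    · refine (isHomogeneous_X _ _).sub (IsHomogeneous.sum _ _ _ fun j _ => ?_)
      exact Submodule.smul_mem (homogeneousSubmodule σ K 1) _ (hℓ1 j)
    · refine Finset.sum_induction _ P Padd ?_ fun j _ => ?_
      · simpa using PC 0
      · rw [MvPolynomial.smul_eq_C_mul]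
        exact Pmul _ _ (PC _) (Pℓ j (by omega))
  have Pall : ∀ f, P f := fun f =>
    MvPolynomial.induction_on f PC Padd fun p i hp => Pmul _ _ hp (PX i)
  intro f hf
  obtain ⟨N, g, hg⟩ := Pall f
  have hg0 : g = 0 := by
    refine eq_zero_of_aeval_X_pow (m := m) g ?_
    have h3 := hg.1
    rw [_root_.map_sub, _root_.map_mul, hf, mul_zero, zero_sub, neg_eq_zero] at h3
    have e : (aeval F).comp (aeval ![ℓ 0, ℓ 1]) =
        (aeval ![X 0 ^ (m + 2), X 0 ^ (m + 1) * X 1] :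
          MvPolynomial (Fin 2) K →ₐ[K] MvPolynomial (Fin 2) K) := by
      refine algHom_ext fun i => ?_
      rw [AlgHom.comp_apply, aeval_X, aeval_X]
      fin_cases i
      · exact (hℓ 0 (by omega)).trans (by simp)
      · exact (hℓ 1 (by omega)).trans (by simp)
    rw [← e]
    exact h3
  have h3 := hg.2
  rw [hg0, _root_.map_zero, sub_zero, h.map_mul _ _ hf, _root_.map_pow, hℓ 0 (by omega)] at h3
  refine (mul_eq_zero.1 h3).resolve_left (pow_ne_zero _ ?_)
  exact mul_ne_zero (pow_ne_zero _ (X_ne_zero _)) (pow_ne_zero _ (X_ne_zero _))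

end ConormalMaps

/-! ### Conormal maps of degree shift -2 come from thickenings -/

section Integration

variable {K σ : Type*} [Field K] {F : σ → MvPolynomial (Fin 2) K}
  {ψ : MvPolynomial σ K → MvPolynomial (Fin 2) K} {m : ℕ} {ℓ : ℕ → MvPolynomial σ K}

/-- The coefficients of a binary form of degree `d`. -/
noncomputable def binaryCoeff (d : ℕ) : MvPolynomial (Fin 2) K →ₗ[K] (Fin (d + 1) → K) :=
  LinearMap.pi fun j => lcoeff K (Finsupp.single 0 (d - (j : ℕ)) + Finsupp.single 1 (j : ℕ))

lemma binaryCoeff_binaryForm (d : ℕ) (c : Fin (d + 1) → K) : binaryCoeff d (binaryForm d c) = c :=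
  funext fun j => coeff_binaryForm d c j

lemma binaryForm_binaryCoeff {d : ℕ} {f : MvPolynomial (Fin 2) K} (hf : f.IsHomogeneous d) :
    binaryForm d (binaryCoeff d f) = f := by
  obtain ⟨c, rfl⟩ : f ∈ LinearMap.range (binaryForm d) := by
    rw [range_binaryForm]; exact hf
  rw [binaryCoeff_binaryForm]

lemma binaryForm_single (d j : ℕ) (hj : j < d + 1) :
    binaryForm d (Pi.single ⟨j, hj⟩ (1 : K)) = X 0 ^ (d - j) * X 1 ^ j := by
  rw [binaryForm, Fintype.linearCombination_apply_single, one_smul]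

/-- Every conormal map of the rational normal curve of degree `m + 2` which lowers the degree
by `2` comes from a first order thickening of the parametrization. -/
theorem IsConormalMap.exists_firstOrder [IsAlgClosed K] [CharZero K] (h : IsConormalMap F ψ)
    (hF : ∀ i, (F i).IsHomogeneous (m + 2))
    (hℓ : ∀ j ≤ m + 2, aeval F (ℓ j) = X 0 ^ (m + 2 - j) * X 1 ^ j)
    (hℓ1 : ∀ j, (ℓ j).IsHomogeneous 1)
    (hψ : ∀ d f, aeval F f = 0 → f.IsHomogeneous (d + 1) → (ψ f).IsHomogeneous ((m + 2) * d + m)) :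
    ∃ G : σ → MvPolynomial (Fin 2) K, (∀ i, (G i).IsHomogeneous m) ∧
      ∀ f, aeval F f = 0 → ψ f = (firstOrder F G f).snd := by
  choose! β hβ using fun i (hi : i ≤ m) => h.dvd_minor hℓ hi
  have hβ' : ∀ i ≤ m, (β i).IsHomogeneous (m + 2) := by
    intro i hi
    have e : (m + 2) * 1 + m = ((m - i) + i) + (m + 2) := by omega
    refine isHomogeneous_of_mul_left (isHomogeneous_X_pow_mul_X_pow (K := K) (m - i) i)
      (mul_ne_zero (pow_ne_zero _ (X_ne_zero _)) (pow_ne_zero _ (X_ne_zero _))) ?_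
    rw [← hβ i hi, ← e]
    exact hψ 1 _ (aeval_minor hℓ (by omega) (by omega))
      (((hℓ1 _).mul (hℓ1 _)).sub ((hℓ1 _).mul (hℓ1 _)))
  -- The form `p_j` is the intended first order part of `ℓ_j`.
  obtain ⟨p, hp, hpβ⟩ := exists_secondDifference_eq β hβ'
  let c : MvPolynomial σ K →ₗ[K] (Fin (m + 3) → K) := binaryCoeff (m + 2) ∘ₗ (aeval F).toLinearMap
  let s : MvPolynomial σ K →ₗ[K] MvPolynomial σ K :=
    Fintype.linearCombination K (fun j : Fin (m + 3) => ℓ j) ∘ₗ c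
  have hs : ∀ f, f.IsHomogeneous 1 → aeval F (f - s f) = 0 := by
    intro f hf
    have h1 : binaryForm (m + 2) (c f) = aeval F f :=
      binaryForm_binaryCoeff (by simpa using hf.aeval F hF)
    rw [_root_.map_sub, sub_eq_zero, ← h1]
    simp only [s, LinearMap.comp_apply, Fintype.linearCombination_apply, map_sum, _root_.map_smul,
      binaryForm]
    exact Finset.sum_congr rfl fun j _ => by rw [hℓ j (by omega)]
  -- A linear form splits as `s f`, a combination of the `ℓ_j`, plus `f - s f`, which vanishes on
  -- the curve. The first order part is prescribed by `p` on the former and by `ψ` on the latter.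
  let E : MvPolynomial σ K → MvPolynomial (Fin 2) K := fun f =>
    Fintype.linearCombination K (fun j : Fin (m + 3) => p j) (c f) + ψ (f - s f)
  have hs1 : ∀ f, (s f).IsHomogeneous 1 := fun f => by
    simp only [s, LinearMap.comp_apply, Fintype.linearCombination_apply]
    exact Submodule.sum_mem (homogeneousSubmodule σ K 1) fun j _ =>
      Submodule.smul_mem _ _ (hℓ1 j)
  have hcℓ : ∀ j (hj : j < m + 3), c (ℓ j) = Pi.single ⟨j, hj⟩ 1 := by
    intro j hj
    simp only [c, LinearMap.comp_apply, AlgHom.toLinearMap_apply]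
    rw [hℓ j (by omega), ← binaryForm_single (m + 2) j hj, binaryCoeff_binaryForm]
  refine ⟨fun i => E (X i), fun i => ?_, ?_⟩
  · refine IsHomogeneous.add ?_ ?_
    · rw [Fintype.linearCombination_apply]
      exact Submodule.sum_mem (homogeneousSubmodule _ K m) fun j _ => Submodule.smul_mem _ _ (hp j)
    · simpa using hψ 0 _ (hs _ (isHomogeneous_X _ _)) ((isHomogeneous_X _ _).sub (hs1 _))
  · set G := fun i => E (X i)
    have hEG : ∀ f, f.IsHomogeneous 1 → E f = (firstOrder F G f).snd := by
      intro f hf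
      have hf' : f ∈ Submodule.span K (Set.range X) := by
        rw [← homogeneousSubmodule_one_eq_span_X]; exact hf
      clear hf
      refine (Submodule.span_induction (p := fun f _ => f.IsHomogeneous 1 ∧
        E f = (firstOrder F G f).snd) ?_ ?_ ?_ ?_ hf').2
      · rintro _ ⟨i, rfl⟩
        exact ⟨isHomogeneous_X _ _, (snd_firstOrder_X (F := F) (G := G) i).symm⟩
      · refine ⟨isHomogeneous_zero _ _ _, ?_⟩
        simp [E, h.map_zero]
      · rintro f g _ _ ⟨hf, ef⟩ ⟨hg, eg⟩
        refine ⟨hf.add hg, ?_⟩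
        rw [snd_firstOrder_add, ← ef, ← eg]
        simp only [E, _root_.map_add]
        rw [add_sub_add_comm, h.map_add _ _ (hs f hf) (hs g hg)]
        ring
      · rintro a f _ ⟨hf, ef⟩
        refine ⟨Submodule.smul_mem (homogeneousSubmodule σ K 1) _ hf, ?_⟩
        rw [snd_firstOrder_smul, ← ef]
        simp only [E, _root_.map_smul]
        rw [← smul_sub, h.map_smul _ (hs f hf), smul_add]
    have hGℓ : ∀ j ≤ m + 2, (firstOrder F G (ℓ j)).snd = p j := by
      intro j hj
      rw [← hEG _ (hℓ1 j)]
      simp only [E]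
      have : s (ℓ j) = ℓ j := by
        simp only [s, LinearMap.comp_apply]
        rw [hcℓ j (by omega), Fintype.linearCombination_apply_single, one_smul]
      rw [this, sub_self, h.map_zero, add_zero, hcℓ j (by omega),
        Fintype.linearCombination_apply_single, one_smul]
    intro f hf
    -- The difference vanishes on linear forms by the choice of `E`, and on the quadrics by the
    -- difference equation.
    have key := (h.sub (isConormalMap_firstOrder (G := G))).eq_zero hF hℓ hℓ1 ?_ ?_ f hf
    · exact sub_eq_zero.1 key
    · intro f hf hf1
      have hcf : c f = 0 := by
        simp only [c, LinearMap.comp_apply, AlgHom.toLinearMap_apply, hf, _root_.map_zero]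
      rw [sub_eq_zero, ← hEG f hf1]
      simp [E, s, hcf]
    · intro i hi
      rw [sub_eq_zero, hβ i hi, ← hpβ i hi, minor, snd_firstOrder_sub, snd_firstOrder_mul,
        snd_firstOrder_mul, hGℓ i (by omega), hGℓ (i + 1) (by omega), hGℓ (i + 1 + 1) (by omega),
        hℓ i (by omega), hℓ (i + 1) (by omega), hℓ (i + 1 + 1) (by omega),
        show m + 2 - i = m - i + 2 by omega, show m + 2 - (i + 1) = m - i + 1 by omega,
        show m + 2 - (i + 1 + 1) = m - i by omega]
      ring

end Integration

/-! ### Invertible quotients of a conormal module -/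

section Conormal

variable {A : Type*} [CommRing A] {I J : Ideal A}

/-- Two representatives of a cotangent class differ by an element of `I²`, which lies in `J`. -/
lemma toCotangent_mem_conormalSubmodule (h2 : I ^ 2 ≤ J) (x : I) :
    I.toCotangent x ∈ conormalSubmodule I J ↔ (x : A) ∈ J := by
  constructor
  · intro hx
    obtain ⟨y, hy, hyx⟩ : ∃ y : I, (y : A) ∈ J ∧ I.toCotangent y = I.toCotangent x := by
      refine Submodule.span_induction (p := fun z _ => ∃ y : I, (y : A) ∈ J ∧ I.toCotangent y = z)
        ?_ ?_ ?_ ?_ hx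
      · rintro _ ⟨y, hy, rfl⟩
        exact ⟨y, hy, rfl⟩
      · exact ⟨0, J.zero_mem, map_zero _⟩
      · rintro _ _ _ _ ⟨y, hy, rfl⟩ ⟨z, hz, rfl⟩
        exact ⟨y + z, J.add_mem hy hz, map_add _ _ _⟩
      · rintro a _ _ ⟨y, hy, rfl⟩
        obtain ⟨a, rfl⟩ := Ideal.Quotient.mk_surjective a
        exact ⟨a • y, J.mul_mem_left a hy, map_smul _ _ _⟩
    rw [Ideal.toCotangent_eq] at hyx
    have := J.sub_mem hy (h2 hyx)
    simpa using this
  · intro hx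
    exact Submodule.subset_span ⟨x, hx, rfl⟩

variable (I J) in
/-- The quotient of the conormal module `I / I²` by `J / I²`. -/
abbrev ConormalQuotient : Type _ := I.Cotangent ⧸ conormalSubmodule I J

variable (I J) in
/-- The class of an element of `I` in the quotient of `I / I²` by `J / I²`. -/
noncomputable def conormalClass (x : I) : ConormalQuotient I J :=
  (conormalSubmodule I J).mkQ (I.toCotangent x)

lemma conormalClass_eq_zero (h2 : I ^ 2 ≤ J) (x : I) :
    conormalClass I J x = 0 ↔ (x : A) ∈ J := by
  rw [conormalClass, Submodule.mkQ_apply, Submodule.Quotient.mk_eq_zero,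
    toCotangent_mem_conormalSubmodule h2]

lemma conormalClass_surjective : Function.Surjective (conormalClass I J) :=
  (Submodule.mkQ_surjective _).comp I.toCotangent_surjective

lemma conormalClass_smul (a : A) (x : I) :
    conormalClass I J (a • x) = Ideal.Quotient.mk I a • conormalClass I J x := by
  rw [conormalClass, conormalClass, map_smul, ← map_smul]
  rfl

lemma conormalClass_sub (x y : I) :
    conormalClass I J (x - y) = conormalClass I J x - conormalClass I J y := by
  simp only [conormalClass, map_sub]

lemma exists_dual_ne_zero {B M : Type*} [CommRing B] [AddCommGroup M] [Module B M]
    [Module.Invertible B M] {x : M} (hx : x ≠ 0) : ∃ φ : Module.Dual B M, φ x ≠ 0 := by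
  by_contra! h
  exact hx ((Module.forall_dual_apply_eq_zero_iff B x).1 h)

lemma smul_eq_zero_of_invertible {B M : Type*} [CommRing B] [IsDomain B] [AddCommGroup M]
    [Module B M] [Module.Invertible B M] {b : B} {x : M} (h : b • x = 0) : b = 0 ∨ x = 0 := by
  by_contra! hbx
  obtain ⟨φ, hφ⟩ := exists_dual_ne_zero (B := B) hbx.2
  have := congrArg φ h
  rw [map_smul, map_zero, smul_eq_mul] at this
  exact (mul_ne_zero hbx.1 hφ) this

/-- Rank one in elementary terms: the endomorphism `z ↦ φ(z) x` of an invertible module is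
multiplication by a scalar `c`, and at `z = y` this reads `φ(y) x = c y`. -/
lemma exists_smul_eq_smul_of_invertible {B M : Type*} [CommRing B] [AddCommGroup M]
    [Module B M] [Module.Invertible B M] (x : M) {y : M} (hy : y ≠ 0) :
    ∃ a b : B, a ≠ 0 ∧ a • x = b • y := by
  obtain ⟨φ, hφ⟩ := exists_dual_ne_zero (B := B) hy
  obtain ⟨c, hc⟩ := (Module.Invertible.toModuleEnd_bijective (R := B) (M := M)).2
    (φ.smulRight x)
  exact ⟨φ y, c, hφ, by simpa using (LinearMap.congr_fun hc y).symm⟩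

section

variable [Module.Invertible (A ⧸ I) (ConormalQuotient I J)]

lemma mem_of_mul_mem_of_invertible [I.IsPrime] (h2 : I ^ 2 ≤ J) {a x : A} (ha : a ∉ I)
    (hx : x ∈ I) (hax : a * x ∈ J) : x ∈ J := by
  have h1 : conormalClass I J (a • ⟨x, hx⟩) = 0 := (conormalClass_eq_zero h2 _).2 hax
  rw [conormalClass_smul] at h1
  rcases smul_eq_zero_of_invertible h1 with h | h
  · exact absurd (Ideal.Quotient.eq_zero_iff_mem.1 h) ha
  · exact (conormalClass_eq_zero h2 _).1 h

lemma exists_mul_sub_mul_mem_of_invertible (h2 : I ^ 2 ≤ J) {x y : A}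
    (hx : x ∈ I) (hy : y ∈ I) (hyJ : y ∉ J) : ∃ a b, a ∉ I ∧ a * x - b * y ∈ J := by
  obtain ⟨a, b, ha, hab⟩ := exists_smul_eq_smul_of_invertible (B := A ⧸ I)
    (conormalClass I J ⟨x, hx⟩) (y := conormalClass I J ⟨y, hy⟩)
    (fun h => hyJ ((conormalClass_eq_zero h2 _).1 h))
  obtain ⟨a, rfl⟩ := Ideal.Quotient.mk_surjective a
  obtain ⟨b, rfl⟩ := Ideal.Quotient.mk_surjective b
  refine ⟨a, b, fun h => ha (Ideal.Quotient.eq_zero_iff_mem.2 h), ?_⟩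
  rw [← conormalClass_smul, ← conormalClass_smul, ← sub_eq_zero, ← conormalClass_sub,
    conormalClass_eq_zero h2] at hab
  exact hab

lemma exists_notMem_of_invertible (h2 : I ^ 2 ≤ J) (hI : I ≠ ⊤) : ∃ x ∈ I, x ∉ J := by
  by_contra! h
  have h0 : ∀ z : ConormalQuotient I J, z = 0 := by
    intro z
    obtain ⟨x, rfl⟩ := conormalClass_surjective z
    exact (conormalClass_eq_zero h2 _).2 (h x x.2)
  have h1 : (1 : A ⧸ I) = 0 := FaithfulSMul.eq_of_smul_eq_smul (α := ConormalQuotient I J)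
    fun z => by rw [h0 z, smul_zero, smul_zero]
  exact hI ((Ideal.eq_top_iff_one I).2 (Ideal.Quotient.eq_zero_iff_mem.1 (by simpa using h1)))

end

/-- The class of `e` is a free generator: `hinj` says that its annihilator is trivial over `A ⧸ I`,
`hsurj` that it spans. -/
lemma invertible_conormalQuotient_of_generator (h2 : I ^ 2 ≤ J) {e : A} (he : e ∈ I)
    (hinj : ∀ a, a * e ∈ J → a ∈ I) (hsurj : ∀ x ∈ I, ∃ a, x - a * e ∈ J) :
    Module.Invertible (A ⧸ I) (ConormalQuotient I J) := by
  let f : (A ⧸ I) →ₗ[A ⧸ I] ConormalQuotient I J :=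
    LinearMap.toSpanSingleton _ _ (conormalClass I J ⟨e, he⟩)
  refine Module.Invertible.congr (LinearEquiv.ofBijective f ⟨?_, ?_⟩)
  · rw [← LinearMap.ker_eq_bot, LinearMap.ker_eq_bot']
    intro a ha
    obtain ⟨a, rfl⟩ := Ideal.Quotient.mk_surjective a
    rw [LinearMap.toSpanSingleton_apply, ← conormalClass_smul, conormalClass_eq_zero h2] at ha
    exact Ideal.Quotient.eq_zero_iff_mem.2 (hinj a ha)
  · intro z
    obtain ⟨x, rfl⟩ := conormalClass_surjective z
    obtain ⟨a, ha⟩ := hsurj x x.2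
    refine ⟨Ideal.Quotient.mk I a, ?_⟩
    rw [LinearMap.toSpanSingleton_apply, ← conormalClass_smul, eq_comm, ← sub_eq_zero,
      ← conormalClass_sub, conormalClass_eq_zero h2]
    exact ha

lemma invertible_conormalQuotient_of_eq_top (hI : I = ⊤) (h2 : I ^ 2 ≤ J) :
    Module.Invertible (A ⧸ I) (ConormalQuotient I J) := by
  have hJ : J = ⊤ := top_unique (by simpa [hI, Ideal.top_pow] using h2)
  exact invertible_conormalQuotient_of_generator h2 I.zero_mem (by simp [hI])
    fun x _ => ⟨0, by simp [hJ]⟩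

end Conormal

/-! ### Fractions on the standard affine charts -/

section Charts

variable {K : Type*} [Field K] {n : ℕ}

/-- The fraction `f / x_i^d` on the `i`-th chart, for a form `f` of degree `d`. -/
noncomputable def chartFrac (i : Fin (n + 1)) (d : ℕ) (f : CoordRing K n)
    (hf : f.IsHomogeneous d) : ChartRing K n i :=
  HomogeneousLocalization.Away.mk _ ((mem_homogeneousSubmodule 1 _).2 (isHomogeneous_X K i)) d f
    ((mem_homogeneousSubmodule _ _).2 (by rwa [smul_eq_mul, mul_one]))

variable {i : Fin (n + 1)}

lemma exists_chartFrac (z : ChartRing K n i) : ∃ d f hf, z = chartFrac i d f hf := by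
  obtain ⟨d, f, hf, rfl⟩ := HomogeneousLocalization.Away.mk_surjective _ (isHomogeneous_X K i) z
  exact ⟨d, f, by rw [smul_eq_mul, mul_one] at hf; exact hf, rfl⟩

lemma val_chartFrac {d : ℕ} {f : CoordRing K n} (hf : f.IsHomogeneous d) :
    (chartFrac i d f hf).val = IsLocalization.mk' (Localization.Away (X i : CoordRing K n)) f
      (⟨X i ^ d, d, rfl⟩ : Submonoid.powers (X i : CoordRing K n)) := by
  rw [chartFrac, HomogeneousLocalization.Away.val_mk, Localization.mk_eq_mk']

lemma chartFrac_mul {d e : ℕ} {f g : CoordRing K n} (hf : f.IsHomogeneous d)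
    (hg : g.IsHomogeneous e) :
    chartFrac i d f hf * chartFrac i e g hg = chartFrac i (d + e) (f * g) (hf.mul hg) := by
  apply HomogeneousLocalization.val_injective
  rw [HomogeneousLocalization.val_mul, val_chartFrac, val_chartFrac, val_chartFrac,
    ← IsLocalization.mk'_mul]
  congr 1
  exact Subtype.ext (pow_add _ _ _).symm

lemma chartFrac_sub {d : ℕ} {f g : CoordRing K n} (hf : f.IsHomogeneous d)
    (hg : g.IsHomogeneous d) :
    chartFrac i d f hf - chartFrac i d g hg = chartFrac i d (f - g) (hf.sub hg) := by
  apply HomogeneousLocalization.val_injective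
  rw [HomogeneousLocalization.val_sub, val_chartFrac, val_chartFrac, val_chartFrac,
    IsLocalization.mk'_eq_mul_mk'_one f, IsLocalization.mk'_eq_mul_mk'_one g,
    IsLocalization.mk'_eq_mul_mk'_one (f - g), map_sub, sub_mul]

lemma chartFrac_eq_of_eq_X_pow_mul {d e : ℕ} {f g : CoordRing K n} (hf : f.IsHomogeneous d)
    (hg : g.IsHomogeneous e) (k : ℕ) (hk : e = k + d) (h : g = X i ^ k * f) :
    chartFrac i d f hf = chartFrac i e g hg := by
  subst hk h
  apply HomogeneousLocalization.val_injective
  rw [val_chartFrac, val_chartFrac, IsLocalization.mk'_eq_iff_eq]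
  congr 1
  simp only
  ring

lemma chartFrac_mem_chartIdeal (X' : ClosedSubschemeP K n) {d : ℕ} {f : CoordRing K n}
    (hf : f.IsHomogeneous d) :
    chartFrac i d f hf ∈ X'.chartIdeal i ↔ ∃ k : ℕ, X i ^ k * f ∈ X'.ideal := by
  rw [ClosedSubschemeP.chartIdeal, Ideal.mem_comap, HomogeneousLocalization.algebraMap_apply,
    val_chartFrac, IsLocalization.mk'_mem_map_algebraMap_iff]
  constructor
  · rintro ⟨_, ⟨k, rfl⟩, h⟩
    exact ⟨k, h⟩
  · rintro ⟨k, h⟩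
    exact ⟨_, ⟨k, rfl⟩, h⟩

lemma chartIdeal_sq_le {C X' : ClosedSubschemeP K n} (h : C.ideal ^ 2 ≤ X'.ideal) :
    C.chartIdeal i ^ 2 ≤ X'.chartIdeal i := by
  refine (Ideal.le_comap_pow _ 2).trans (Ideal.comap_mono ?_)
  rw [← Ideal.map_pow]
  exact Ideal.map_mono h

lemma chartFrac_mem_chartIdeal_of_isPrime {C : ClosedSubschemeP K n} (hC : C.ideal.IsPrime)
    (hi : X i ∉ C.ideal) {d : ℕ} {f : CoordRing K n} (hf : f.IsHomogeneous d) :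
    chartFrac i d f hf ∈ C.chartIdeal i ↔ f ∈ C.ideal := by
  rw [chartFrac_mem_chartIdeal]
  exact ⟨fun ⟨k, hk⟩ => (hC.mem_or_mem hk).resolve_left fun h => hi (hC.mem_of_pow_mem k h),
    fun h => ⟨0, by simpa using h⟩⟩

lemma chartIdeal_isPrime {C : ClosedSubschemeP K n} (hC : C.ideal.IsPrime)
    (hi : X i ∉ C.ideal) : (C.chartIdeal i).IsPrime := by
  refine ⟨?_, ?_⟩
  · rw [Ne, Ideal.eq_top_iff_one]
    have h1 : (1 : ChartRing K n i) = chartFrac i 0 1 (isHomogeneous_one _ _) := by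
      apply HomogeneousLocalization.val_injective
      rw [val_chartFrac, HomogeneousLocalization.val_one, eq_comm,
        IsLocalization.mk'_eq_iff_eq_mul]
      simp
    rw [h1, chartFrac_mem_chartIdeal_of_isPrime hC hi]
    exact fun h => hC.ne_top ((Ideal.eq_top_iff_one _).2 h)
  · intro y z hyz
    obtain ⟨d, f, hf, rfl⟩ := exists_chartFrac y
    obtain ⟨e, g, hg, rfl⟩ := exists_chartFrac z
    rw [chartFrac_mul, chartFrac_mem_chartIdeal_of_isPrime hC hi] at hyz
    rw [chartFrac_mem_chartIdeal_of_isPrime hC hi, chartFrac_mem_chartIdeal_of_isPrime hC hi]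
    exact hC.mem_or_mem hyz

lemma chartIdeal_eq_top {C : ClosedSubschemeP K n} (hi : X i ∈ C.ideal) :
    C.chartIdeal i = ⊤ := by
  refine (eq_top_iff).2 fun z _ => ?_
  obtain ⟨d, f, hf, rfl⟩ := exists_chartFrac z
  rw [chartFrac_mem_chartIdeal]
  exact ⟨1, by rw [pow_one]; exact C.ideal.mul_mem_right _ hi⟩

end Charts

/-! ### From a double structure to a graded conormal map -/

section DoubleStructureToConormalMap

variable {K : Type*} [Field K] {n : ℕ} {C Y : ClosedSubschemeP K n}

lemma ClosedSubschemeP.homogeneousComponent_mem (Y : ClosedSubschemeP K n) {f : CoordRing K n}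
    (hf : f ∈ Y.ideal) (d : ℕ) : homogeneousComponent d f ∈ Y.ideal :=
  homogeneousComponent_mem_of_mem Y.homogeneous hf d

lemma mem_of_homogeneousComponent_mem {J : Ideal (CoordRing K n)} {f : CoordRing K n}
    (h : ∀ d, homogeneousComponent d f ∈ J) : f ∈ J := by
  rw [← sum_homogeneousComponent f]
  exact J.sum_mem fun d _ => h d

lemma sq_le_of_mul_mem {I J : Ideal (CoordRing K n)} (h : I ^ 2 ≤ J) {f g : CoordRing K n}
    (hf : f ∈ I) (hg : g ∈ I) : f * g ∈ J :=
  h (by rw [pow_two]; exact Ideal.mul_mem_mul hf hg)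

/-- The quotient `I_C / I_X` is torsion free. -/
lemma IsDoubleStructure.mem_of_mul_mem (hD : IsDoubleStructure C Y) (hC : C.ideal.IsPrime)
    {d e : ℕ} {a f : CoordRing K n} (ha : a.IsHomogeneous e) (hf : f.IsHomogeneous d)
    (haC : a ∉ C.ideal) (hfC : f ∈ C.ideal) (haf : a * f ∈ Y.ideal) : f ∈ Y.ideal := by
  refine Y.saturated f fun i => ?_
  by_cases hi : X i ∈ C.ideal
  -- On a chart missing the curve, `x_i f` already lies in the square of the ideal of `C`.
  · exact ⟨1, by rw [pow_one]; exact sq_le_of_mul_mem hD.1 hi hfC⟩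
  · have hprime := chartIdeal_isPrime hC hi
    have hinv := hD.2.2 i
    rw [← chartFrac_mem_chartIdeal Y hf]
    refine mem_of_mul_mem_of_invertible (I := C.chartIdeal i) (chartIdeal_sq_le hD.1)
      (a := chartFrac i e a ha) ?_ ?_ ?_
    · rwa [chartFrac_mem_chartIdeal_of_isPrime hC hi]
    · rwa [chartFrac_mem_chartIdeal_of_isPrime hC hi]
    · rw [chartFrac_mul, chartFrac_mem_chartIdeal]
      exact ⟨0, by simpa using haf⟩

/-- The quotient `I_C / I_X` has rank at most one. -/
lemma IsDoubleStructure.exists_mul_sub_mul_mem (hD : IsDoubleStructure C Y) (hC : C.ideal.IsPrime)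
    {i : Fin (n + 1)} (hi : X i ∉ C.ideal) {d d₀ : ℕ} {f f₀ : CoordRing K n}
    (hf : f.IsHomogeneous d) (hf₀ : f₀.IsHomogeneous d₀) (hfC : f ∈ C.ideal)
    (hf₀C : f₀ ∈ C.ideal) (hf₀Y : f₀ ∉ Y.ideal) :
    ∃ e a b, a.IsHomogeneous e ∧ a ∉ C.ideal ∧ a * f - b * f₀ ∈ Y.ideal := by
  have hprime := chartIdeal_isPrime hC hi
  have hinv := hD.2.2 i
  obtain ⟨α, β, hα, hαβ⟩ := exists_mul_sub_mul_mem_of_invertible (I := C.chartIdeal i)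
    (J := Y.chartIdeal i) (chartIdeal_sq_le hD.1) (x := chartFrac i d f hf)
    (y := chartFrac i d₀ f₀ hf₀) ((chartFrac_mem_chartIdeal_of_isPrime hC hi hf).2 hfC)
    ((chartFrac_mem_chartIdeal_of_isPrime hC hi hf₀).2 hf₀C) (by
      rw [chartFrac_mem_chartIdeal]
      rintro ⟨k, hk⟩
      exact hf₀Y (hD.mem_of_mul_mem hC (isHomogeneous_X_pow i k) hf₀
        (fun h => hi (hC.mem_of_pow_mem k h)) hf₀C hk))
  obtain ⟨e, a, ha, rfl⟩ := exists_chartFrac α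
  obtain ⟨e', b, hb, rfl⟩ := exists_chartFrac β
  -- Powers of `x_i` bring both fractions to a common degree, so that their difference is again a
  -- single fraction.
  have hpad : ∀ {p : ℕ} {g : CoordRing K n} (_ : g.IsHomogeneous p) (q : ℕ),
      (X i ^ q * g).IsHomogeneous (q + p) := fun hg q => (isHomogeneous_X_pow i q).mul hg
  rw [chartFrac_mul, chartFrac_mul,
    chartFrac_eq_of_eq_X_pow_mul (ha.mul hf) (hpad (ha.mul hf) (e' + d₀)) (e' + d₀) rfl rfl,
    chartFrac_eq_of_eq_X_pow_mul (hb.mul hf₀) (g := X i ^ (e + d) * (b * f₀))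
      (e := e' + d₀ + (e + d)) (by rw [add_comm (e' + d₀)]; exact hpad (hb.mul hf₀) (e + d))
      (e + d) (add_comm _ _) rfl, chartFrac_sub, chartFrac_mem_chartIdeal] at hαβ
  obtain ⟨k, hk⟩ := hαβ
  refine ⟨_, X i ^ (k + (e' + d₀)) * a, X i ^ (k + (e + d)) * b, hpad ha _, ?_, ?_⟩
  · intro h
    rcases hC.mem_or_mem h with h | h
    · exact hi (hC.mem_of_pow_mem _ h)
    · exact hα ((chartFrac_mem_chartIdeal_of_isPrime hC hi ha).2 h)
  · convert hk using 1
    ring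

lemma IsDoubleStructure.exists_isHomogeneous_notMem (hD : IsDoubleStructure C Y)
    (hC : C.ideal.IsPrime) {i : Fin (n + 1)} (hi : X i ∉ C.ideal) :
    ∃ d, ∃ f : CoordRing K n, f.IsHomogeneous d ∧ f ∈ C.ideal ∧ f ∉ Y.ideal := by
  have hprime := chartIdeal_isPrime hC hi
  have hinv := hD.2.2 i
  obtain ⟨z, hz, hzY⟩ := exists_notMem_of_invertible (I := C.chartIdeal i) (J := Y.chartIdeal i)
    (chartIdeal_sq_le hD.1) hprime.ne_top
  obtain ⟨d, f, hf, rfl⟩ := exists_chartFrac z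
  refine ⟨d, f, hf, (chartFrac_mem_chartIdeal_of_isPrime hC hi hf).1 hz, fun h => hzY ?_⟩
  rw [chartFrac_mem_chartIdeal]
  exact ⟨0, by simpa using h⟩

/-- A single denominator works for all of `I_C`. -/
lemma IsDoubleStructure.exists_common_denominator (hD : IsDoubleStructure C Y)
    (hC : C.ideal.IsPrime) {i : Fin (n + 1)} (hi : X i ∉ C.ideal) {d₀ : ℕ} {f₀ : CoordRing K n}
    (hf₀ : f₀.IsHomogeneous d₀) (hf₀C : f₀ ∈ C.ideal) (hf₀Y : f₀ ∉ Y.ideal) :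
    ∃ e a, a.IsHomogeneous e ∧ a ∉ C.ideal ∧ ∀ f ∈ C.ideal, ∃ b, a * f - b * f₀ ∈ Y.ideal := by
  have hadd : ∀ {f g : CoordRing K n} {a a' b b' : CoordRing K n}, a * f - b * f₀ ∈ Y.ideal →
      a' * g - b' * f₀ ∈ Y.ideal →
      a * a' * (f + g) - (a' * b + a * b') * f₀ ∈ Y.ideal := by
    intro f g a a' b b' h h'
    have := Y.ideal.add_mem (Y.ideal.mul_mem_left a' h) (Y.ideal.mul_mem_left a h')
    convert this using 1
    ring
  let Q : CoordRing K n → Prop := fun f =>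
    ∃ e a b, a.IsHomogeneous e ∧ a ∉ C.ideal ∧ a * f - b * f₀ ∈ Y.ideal
  have hQ : ∀ f ∈ C.ideal, Q f := by
    intro f hf
    rw [← sum_homogeneousComponent f]
    refine Finset.sum_induction _ Q ?_ ?_ fun d _ => hD.exists_mul_sub_mul_mem hC hi
      (homogeneousComponent_isHomogeneous d f) hf₀ (C.homogeneousComponent_mem hf d) hf₀C hf₀Y
    · rintro f g ⟨e, a, b, ha, haC, h⟩ ⟨e', a', b', ha', haC', h'⟩
      exact ⟨_, _, _, ha.mul ha', fun h => (hC.mem_or_mem h).elim haC haC', hadd h h'⟩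
    · exact ⟨0, 1, 0, isHomogeneous_one _ _, fun h => hC.ne_top ((Ideal.eq_top_iff_one _).2 h),
        by simp⟩
  have key : ∀ N : Ideal (CoordRing K n), N.FG → N ≤ C.ideal →
      ∃ e a, a.IsHomogeneous e ∧ a ∉ C.ideal ∧ ∀ f ∈ N, ∃ b, a * f - b * f₀ ∈ Y.ideal := by
    intro N hN
    refine Submodule.fg_induction (motive := fun N _ => N ≤ C.ideal →
      ∃ e a, a.IsHomogeneous e ∧ a ∉ C.ideal ∧ ∀ f ∈ N, ∃ b, a * f - b * f₀ ∈ Y.ideal) ?_ ?_ N hN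
    · intro f hf
      obtain ⟨e, a, b, ha, haC, h⟩ := hQ f (hf (Submodule.mem_span_singleton_self f))
      refine ⟨e, a, ha, haC, fun g hg => ?_⟩
      obtain ⟨s, rfl⟩ := Submodule.mem_span_singleton.1 hg
      refine ⟨s * b, ?_⟩
      convert Y.ideal.mul_mem_left s h using 1
      rw [smul_eq_mul]; ring
    · intro N₁ N₂ _ _ h₁ h₂ hle
      obtain ⟨e, a, ha, haC, h⟩ := h₁ (le_sup_left.trans hle)
      obtain ⟨e', a', ha', haC', h'⟩ := h₂ (le_sup_right.trans hle)
      refine ⟨_, _, ha.mul ha', fun h => (hC.mem_or_mem h).elim haC haC', fun f hf => ?_⟩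
      obtain ⟨g, hg, g', hg', rfl⟩ := Submodule.mem_sup.1 hf
      obtain ⟨b, hb⟩ := h g hg
      obtain ⟨b', hb'⟩ := h' g' hg'
      exact ⟨_, hadd hb hb'⟩
  exact key _ (IsNoetherian.noetherian _) le_rfl

variable {r : ℕ} {F : Fin (n + 1) → MvPolynomial (Fin 2) K}

/-- A double structure on a parametrized curve is the kernel of a graded conormal map. -/
theorem IsDoubleStructure.exists_conormalMap (hD : IsDoubleStructure C Y)
    (hF : ∀ i, (F i).IsHomogeneous r) (hCF : ∀ f, f ∈ C.ideal ↔ aeval F f = 0)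
    {i : Fin (n + 1)} (hi : F i ≠ 0) :
    ∃ (ψ : CoordRing K n → MvPolynomial (Fin 2) K) (δ : ℕ), IsConormalMap F ψ ∧
      (∀ f, aeval F f = 0 → (ψ f = 0 ↔ f ∈ Y.ideal)) ∧
      (∀ d f, aeval F f = 0 → f.IsHomogeneous d → (ψ f).IsHomogeneous (r * (d + δ))) ∧
      ∃ d f, f.IsHomogeneous d ∧ aeval F f = 0 ∧ ψ f ≠ 0 := by
  classical
  have hC : C.ideal.IsPrime := by
    have : C.ideal = RingHom.ker (aeval F : CoordRing K n →ₐ[K] MvPolynomial (Fin 2) K) := by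
      ext f; exact hCF f
    rw [this]
    exact RingHom.ker_isPrime _
  have hiC : X i ∉ C.ideal := by rw [hCF, aeval_X]; exact hi
  obtain ⟨d₀, f₀, hf₀, hf₀C, hf₀Y⟩ := hD.exists_isHomogeneous_notMem hC hiC
  obtain ⟨δ, a, ha, haC, hab⟩ : ∃ δ a, a.IsHomogeneous (d₀ + δ) ∧ a ∉ C.ideal ∧
      ∀ f ∈ C.ideal, ∃ b, a * f - b * f₀ ∈ Y.ideal := by
    obtain ⟨e, a, ha, haC, h⟩ := hD.exists_common_denominator hC hiC hf₀ hf₀C hf₀Y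
    -- The factor `x_i^{d₀}` makes the degree of the denominator at least `d₀`, so that the shift
    -- `δ` is a natural number.
    refine ⟨e, X i ^ d₀ * a, (isHomogeneous_X_pow i d₀).mul ha, fun h => ?_, fun f hf => ?_⟩
    · exact (hC.mem_or_mem h).elim (fun h => hiC (hC.mem_of_pow_mem _ h)) haC
    · obtain ⟨b, hb⟩ := h f hf
      refine ⟨X i ^ d₀ * b, ?_⟩
      convert Y.ideal.mul_mem_left (X i ^ d₀) hb using 1
      ring
  have hcancel : ∀ c, c * f₀ ∈ Y.ideal → c ∈ C.ideal := by
    intro c hc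
    refine mem_of_homogeneousComponent_mem fun k => ?_
    by_contra hk
    refine hf₀Y (hD.mem_of_mul_mem hC (homogeneousComponent_isHomogeneous k c) hf₀ hk hf₀C ?_)
    rw [mul_comm, ← homogeneousComponent_mul_of_isHomogeneous hf₀, mul_comm]
    exact Y.homogeneousComponent_mem hc _
  choose! b hb using hab
  -- Morally `ψ f = a f / f₀`, where `f₀` generates the line bundle generically. The numerator `b f`
  -- is an arbitrary choice, but `hcancel` makes its restriction to the curve unique.
  let ψ : CoordRing K n → MvPolynomial (Fin 2) K := fun f => aeval F (b f)
  have hψ : ∀ f c, f ∈ C.ideal → a * f - c * f₀ ∈ Y.ideal → ψ f = aeval F c := by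
    intro f c hf hc
    have h1 : (c - b f) * f₀ ∈ Y.ideal := by
      convert Y.ideal.sub_mem (hb f hf) hc using 1
      ring
    have h2 := (hCF _).1 (hcancel _ h1)
    rw [map_sub, sub_eq_zero] at h2
    exact h2.symm
  refine ⟨ψ, δ, ⟨?_, ?_⟩, ?_, ?_, ?_⟩
  · intro f g hf hg
    rw [← hCF] at hf hg
    rw [hψ (f + g) (b f + b g) (C.ideal.add_mem hf hg), map_add]
    convert Y.ideal.add_mem (hb f hf) (hb g hg) using 1
    ring
  · intro s f hf
    rw [← hCF] at hf
    rw [hψ (s * f) (s * b f) (C.ideal.mul_mem_left _ hf), map_mul]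
    convert Y.ideal.mul_mem_left s (hb f hf) using 1
    ring
  · intro f hf
    rw [← hCF] at hf
    constructor
    · intro h0
      have h1 : b f * f₀ ∈ Y.ideal := sq_le_of_mul_mem hD.1 ((hCF _).2 h0) hf₀C
      have h2 : a * f ∈ Y.ideal := by
        convert Y.ideal.add_mem (hb f hf) h1 using 1
        ring
      refine mem_of_homogeneousComponent_mem fun k => ?_
      refine hD.mem_of_mul_mem hC ha (homogeneousComponent_isHomogeneous k f) haC
        (C.homogeneousComponent_mem hf k) ?_
      rw [← homogeneousComponent_mul_of_isHomogeneous ha]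
      exact Y.homogeneousComponent_mem h2 _
    · intro hY
      rw [hψ f 0 hf, map_zero]
      rw [zero_mul, sub_zero]
      exact Y.ideal.mul_mem_left _ hY
  · intro d f hf hfd
    rw [← hCF] at hf
    rw [hψ f (homogeneousComponent (d + δ) (b f)) hf]
    · exact (homogeneousComponent_isHomogeneous _ _).aeval F hF
    · have h1 := Y.homogeneousComponent_mem (hb f hf) (d₀ + δ + d)
      rw [map_sub, homogeneousComponent_eq_self (ha.mul hfd), mul_comm (b f),
        show d₀ + δ + d = d₀ + (d + δ) by ring,
        homogeneousComponent_mul_of_isHomogeneous hf₀] at h1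
      rwa [mul_comm _ f₀]
  · refine ⟨d₀, f₀, hf₀, (hCF _).1 hf₀C, ?_⟩
    rw [hψ f₀ a hf₀C (by rw [sub_self]; exact Y.ideal.zero_mem)]
    exact fun h => haC ((hCF _).2 h)

end DoubleStructureToConormalMap

/-! ### Zeros of binary forms on the projective line -/

section BinaryFormsZeros

variable {K : Type*} [Field K]

/-- A binary form vanishing at a point of the projective line is divisible by the linear form of
that point. -/
lemma linear_dvd_of_eval_eq_zero {g : MvPolynomial (Fin 2) K} {k : ℕ} (hg : g.IsHomogeneous k)
    {p : Fin 2 → K} (hp : p ≠ 0) (h0 : eval p g = 0) :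
    C (p 1) * X 0 - C (p 0) * X 1 ∣ g := by
  obtain ⟨i, hi⟩ : ∃ i, p i ≠ 0 := by
    by_contra! h
    exact hp (funext h)
  set H : MvPolynomial (Fin 2) K := C (p 1) * X 0 - C (p 0) * X 1
  let q := Ideal.Quotient.mkₐ K (Ideal.span {H})
  -- Modulo `H`, `p_i X_j` equals `X_i p_j`. By homogeneity `p_i^k g` is then congruent to `X_i^k
  -- g(p) = 0`.
  have h1 : aeval (fun j => (C (p i) * X j : MvPolynomial (Fin 2) K)) g = C (p i) ^ k * g := by
    rw [aeval_mul_of_isHomogeneous hg, aeval_X_left_apply]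
  have h2 : aeval (fun j => (X i * C (p j) : MvPolynomial (Fin 2) K)) g = 0 := by
    rw [aeval_mul_of_isHomogeneous hg]
    have : aeval (fun j => (C (p j) : MvPolynomial (Fin 2) K)) g = C (eval p g) := by
      rw [← aeval_eq_eval, ← algebraMap_eq, ← aeval_algebraMap_apply]
      rfl
    rw [this, h0, map_zero, mul_zero]
  have h3 : q (C (p i) ^ k * g) = 0 := by
    rw [← h1, ← map_zero q, ← h2, comp_aeval_apply, comp_aeval_apply]
    refine congrArg (fun y => aeval y g) (funext fun j => ?_)
    refine Ideal.Quotient.eq.2 (Ideal.mem_span_singleton.2 ?_)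
    fin_cases i <;> fin_cases j
    · exact ⟨0, by simp; ring⟩
    · exact ⟨-1, by simp [H]; ring⟩
    · exact ⟨1, by simp [H]; ring⟩
    · exact ⟨0, by simp; ring⟩
  have h4 : H ∣ C (p i) ^ k * g := Ideal.mem_span_singleton.1 (Ideal.Quotient.eq_zero_iff_mem.1 h3)
  rw [← map_pow] at h4
  have h5 : IsUnit (C (p i ^ k) : MvPolynomial (Fin 2) K) :=
    (isUnit_iff_ne_zero.2 (pow_ne_zero _ hi)).map C
  exact (h5.dvd_mul_left).1 h4

lemma isHomogeneous_linear (p : Fin 2 → K) :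
    (C (p 1) * X 0 - C (p 0) * X 1 : MvPolynomial (Fin 2) K).IsHomogeneous 1 :=
  (isHomogeneous_C_mul_X _ _).sub (isHomogeneous_C_mul_X _ _)

lemma linear_ne_zero {p : Fin 2 → K} (hp : p ≠ 0) :
    (C (p 1) * X 0 - C (p 0) * X 1 : MvPolynomial (Fin 2) K) ≠ 0 := by
  intro h
  apply hp
  have h1 := congrArg (eval ![1, 0]) h
  have h0 := congrArg (eval ![0, 1]) h
  simp at h0 h1
  funext i
  fin_cases i
  · exact h0
  · exact h1

/-- An ideal of binary forms without common zeros on the projective line contains all monomials of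
large degree. -/
lemma exists_X_pow_mem [IsAlgClosed K] {𝔟 : Ideal (MvPolynomial (Fin 2) K)}
    (h : ∀ p : Fin 2 → K, p ≠ 0 → ∃ g ∈ 𝔟, eval p g ≠ 0) : ∃ N, ∀ i, X i ^ N ∈ 𝔟 := by
  have hrad : ∀ i, X i ∈ 𝔟.radical := by
    intro i
    rw [← vanishingIdeal_zeroLocus_eq_radical (K := K)]
    intro p hp
    by_cases h0 : p = 0
    · simp [h0]
    · obtain ⟨g, hg, hne⟩ := h p h0
      have := hp g hg
      rw [aeval_eq_eval] at this
      exact absurd this hne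
  choose N hN using hrad
  refine ⟨N 0 + N 1, fun i => 𝔟.pow_mem_of_pow_mem (hN i) ?_⟩
  fin_cases i <;> simp

end BinaryFormsZeros

/-! ### Removing common factors and surjectivity in large degree -/

section Normalization

variable {K σ : Type*} [Field K] {F : σ → MvPolynomial (Fin 2) K} {r : ℕ}

lemma aeval_homogeneousComponent_eq_zero (hr : r ≠ 0) (hF : ∀ i, (F i).IsHomogeneous r)
    {f : MvPolynomial σ K} (hf : aeval F f = 0) (d : ℕ) :
    aeval F (homogeneousComponent d f) = 0 := by
  rw [← homogeneousComponent_aeval hr hF, hf, map_zero]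

lemma IsConormalMap.dvd_of_forall_isHomogeneous {ψ : MvPolynomial σ K → MvPolynomial (Fin 2) K}
    (hψ : IsConormalMap F ψ) (hr : r ≠ 0) (hF : ∀ i, (F i).IsHomogeneous r)
    {H : MvPolynomial (Fin 2) K}
    (h : ∀ d f, f.IsHomogeneous d → aeval F f = 0 → H ∣ ψ f) {f : MvPolynomial σ K}
    (hf : aeval F f = 0) : H ∣ ψ f := by
  have : aeval F f = 0 ∧ H ∣ ψ f := by
    rw [← sum_homogeneousComponent f]
    refine Finset.sum_induction _ (fun f => aeval F f = 0 ∧ H ∣ ψ f) ?_ ?_ fun d _ => ?_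
    · rintro f g ⟨hf, hf'⟩ ⟨hg, hg'⟩
      exact ⟨by rw [_root_.map_add, hf, hg, add_zero],
        by rw [hψ.map_add f g hf hg]; exact dvd_add hf' hg'⟩
    · exact ⟨_root_.map_zero _, by rw [hψ.map_zero]; exact dvd_zero _⟩
    · exact ⟨aeval_homogeneousComponent_eq_zero hr hF hf d,
        h d _ (homogeneousComponent_isHomogeneous d f)
          (aeval_homogeneousComponent_eq_zero hr hF hf d)⟩
  exact this.2

/-- `ψ` is a conormal map, homogeneous up to the shift of degrees `r * d + δ - γ`. -/
structure IsGradedConormalMap (F : σ → MvPolynomial (Fin 2) K) (r δ γ : ℕ)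
    (ψ : MvPolynomial σ K → MvPolynomial (Fin 2) K) : Prop extends IsConormalMap F ψ where
  isHomogeneous : ∀ d k f, aeval F f = 0 → f.IsHomogeneous d → r * d + δ = γ + k →
    (ψ f).IsHomogeneous k
  eq_zero_of_lt : ∀ d f, aeval F f = 0 → f.IsHomogeneous d → r * d + δ < γ → ψ f = 0

/-- Dividing a conormal map by the common factors of its values. -/
theorem IsConormalMap.exists_normalization (hr : r ≠ 0) (hF : ∀ i, (F i).IsHomogeneous r)
    {ψ : MvPolynomial σ K → MvPolynomial (Fin 2) K} (hψ : IsConormalMap F ψ) {δ : ℕ}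
    (hdeg : ∀ d f, aeval F f = 0 → f.IsHomogeneous d → (ψ f).IsHomogeneous (r * d + δ))
    (hne : ∃ d f, f.IsHomogeneous d ∧ aeval F f = 0 ∧ ψ f ≠ 0) :
    ∃ (χ : MvPolynomial σ K → MvPolynomial (Fin 2) K) (γ : ℕ), IsGradedConormalMap F r δ γ χ ∧
      (∀ f, aeval F f = 0 → (χ f = 0 ↔ ψ f = 0)) ∧
      ∀ p : Fin 2 → K, p ≠ 0 → ∃ d f, f.IsHomogeneous d ∧ aeval F f = 0 ∧ eval p (χ f) ≠ 0 := by
  classical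
  obtain ⟨d₀, f₀, hf₀, hf₀F, hf₀ψ⟩ := hne
  -- Divide by a common divisor of maximal degree; the nonzero value `ψ f₀` bounds that degree. A
  -- remaining common zero would give one more linear factor, contradicting maximality.
  let P : ℕ → Prop := fun γ => ∃ G : MvPolynomial (Fin 2) K, G.IsHomogeneous γ ∧ G ≠ 0 ∧
    ∀ f, aeval F f = 0 → G ∣ ψ f
  have hbound : ∀ γ, P γ → γ ≤ r * d₀ + δ := by
    rintro γ ⟨G, hG, hG0, hdvd⟩
    obtain ⟨q, hq⟩ := hdvd f₀ hf₀F
    by_contra! hlt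
    refine hf₀ψ ?_
    rw [hq, eq_zero_of_isHomogeneous_mul_of_lt hG hG0 (k := r * d₀ + δ) (h := q) ?_ hlt, mul_zero]
    rw [← hq]
    exact hdeg d₀ f₀ hf₀F hf₀
  have hP0 : P 0 := ⟨1, isHomogeneous_one _ _, one_ne_zero, fun _ _ => one_dvd _⟩
  have hPγ := Nat.findGreatest_spec (P := P) (Nat.zero_le (r * d₀ + δ)) hP0
  have hmax : ∀ γ', P γ' → γ' ≤ Nat.findGreatest P (r * d₀ + δ) :=
    fun γ' h => Nat.le_findGreatest (hbound γ' h) h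
  set γ := Nat.findGreatest P (r * d₀ + δ)
  obtain ⟨G, hG, hG0, hdvd⟩ := hPγ
  choose! χ hχ using hdvd
  have hconormal : IsConormalMap F χ := by
    refine ⟨fun f g hf hg => mul_left_cancel₀ hG0 ?_, fun a f hf => mul_left_cancel₀ hG0 ?_⟩
    · rw [mul_add, ← hχ f hf, ← hχ g hg, ← hχ _ (by rw [_root_.map_add, hf, hg, add_zero]),
        hψ.map_add f g hf hg]
    · rw [← hχ _ (by rw [_root_.map_mul, hf, mul_zero]), hψ.map_mul a f hf, hχ f hf]
      ring
  refine ⟨χ, γ, ⟨hconormal, ?_, ?_⟩, ?_, ?_⟩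
  · intro d k f hf hfd hk
    refine isHomogeneous_of_mul_left hG hG0 ?_
    rw [← hχ f hf, ← hk]
    exact hdeg d f hf hfd
  · intro d f hf hfd hk
    refine eq_zero_of_isHomogeneous_mul_of_lt hG hG0 (k := r * d + δ) ?_ hk
    rw [← hχ f hf]
    exact hdeg d f hf hfd
  · intro f hf
    rw [hχ f hf, mul_eq_zero, or_iff_right hG0]
  · intro p hp
    by_contra! h
    have hlin : ∀ f, aeval F f = 0 → C (p 1) * X 0 - C (p 0) * X 1 ∣ χ f := by
      intro f hf
      refine hconormal.dvd_of_forall_isHomogeneous hr hF (fun d f hfd hf => ?_) hf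
      by_cases hlt : r * d + δ < γ
      · rw [eq_zero_of_isHomogeneous_mul_of_lt hG hG0 (k := r * d + δ) (h := χ f)
          (by rw [← hχ f hf]; exact hdeg d f hf hfd) hlt]
        exact dvd_zero _
      · obtain ⟨k, hk⟩ := Nat.exists_eq_add_of_le (not_lt.1 hlt)
        refine linear_dvd_of_eval_eq_zero (k := k) ?_ hp (h d f hfd hf)
        refine isHomogeneous_of_mul_left hG hG0 ?_
        rw [← hχ f hf, ← hk]
        exact hdeg d f hf hfd
    have := hmax (γ + 1) ⟨G * (C (p 1) * X 0 - C (p 0) * X 1), hG.mul (isHomogeneous_linear p),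
      mul_ne_zero hG0 (linear_ne_zero hp), fun f hf => by
        rw [hχ f hf]; exact mul_dvd_mul_left G (hlin f hf)⟩
    omega

/-- All binary forms of degree `r * d` are restrictions of forms of degree `d`. -/
lemma exists_aeval_eq {m : ℕ} {ℓ : ℕ → MvPolynomial σ K}
    (hℓ : ∀ j ≤ m + 2, aeval F (ℓ j) = X 0 ^ (m + 2 - j) * X 1 ^ j)
    (hℓ1 : ∀ j, (ℓ j).IsHomogeneous 1) (d : ℕ) {g : MvPolynomial (Fin 2) K}
    (hg : g.IsHomogeneous ((m + 2) * d)) : ∃ a : MvPolynomial σ K, a.IsHomogeneous d ∧ aeval F a = g := by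
  have h1 : homogeneousSubmodule (Fin 2) K (m + 2) ≤
      (homogeneousSubmodule σ K 1).map (aeval F).toLinearMap := by
    refine binaryForms_le _ fun a b hab => ⟨ℓ b, hℓ1 b, ?_⟩
    rw [AlgHom.toLinearMap_apply, hℓ b (by omega)]
    congr
    omega
  suffices homogeneousSubmodule (Fin 2) K ((m + 2) * d) ≤
      (homogeneousSubmodule σ K d).map (aeval F).toLinearMap from this hg
  clear hg g
  induction d with
  | zero =>
    refine binaryForms_le _ fun a b hab => ⟨1, isHomogeneous_one _ _, ?_⟩
    obtain ⟨rfl, rfl⟩ : a = 0 ∧ b = 0 := by omega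
    simp
  | succ d ih =>
    refine binaryForms_add_le _ _ _ fun f g hf hg => ?_
    obtain ⟨a, ha, rfl⟩ := ih hf
    obtain ⟨b, hb, rfl⟩ := h1 hg
    exact ⟨a * b, IsHomogeneous.mul ha hb, by simp⟩

/-- A graded conormal map without common zeros is surjective in large degrees. -/
theorem IsGradedConormalMap.exists_eq_of_large [IsAlgClosed K] {m δ γ : ℕ}
    {ψ : MvPolynomial σ K → MvPolynomial (Fin 2) K} (hψ : IsGradedConormalMap F (m + 2) δ γ ψ)
    {ℓ : ℕ → MvPolynomial σ K} (hℓ : ∀ j ≤ m + 2, aeval F (ℓ j) = X 0 ^ (m + 2 - j) * X 1 ^ j)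
    (hℓ1 : ∀ j, (ℓ j).IsHomogeneous 1)
    (hp : ∀ p : Fin 2 → K, p ≠ 0 → ∃ d f, f.IsHomogeneous d ∧ aeval F f = 0 ∧ eval p (ψ f) ≠ 0) :
    ∃ d₁, ∀ d ≥ d₁, ∃ k, (m + 2) * d + δ = γ + k ∧
      ∀ g : MvPolynomial (Fin 2) K, g.IsHomogeneous k →
        ∃ f, aeval F f = 0 ∧ f.IsHomogeneous d ∧ ψ f = g := by
  let s : Set (MvPolynomial (Fin 2) K) := {g | ∃ d f, f.IsHomogeneous d ∧ aeval F f = 0 ∧ ψ f = g}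
  obtain ⟨N, hN⟩ := exists_X_pow_mem (𝔟 := Ideal.span s) fun p h0 => by
    obtain ⟨d, f, hfd, hf, hne⟩ := hp p h0
    exact ⟨ψ f, Ideal.subset_span ⟨d, f, hfd, hf, rfl⟩, hne⟩
  -- In the relevant degrees the coefficients needed have degree a multiple of `m + 2`, so they lift
  -- to forms on the ambient space. Hence the homogeneous parts of the ideal spanned by the values
  -- are themselves values.
  have key : ∀ g ∈ Ideal.span s, ∀ a d k, (m + 2) * d + δ = γ + k →
      ∃ f, aeval F f = 0 ∧ f.IsHomogeneous d ∧ ψ f = homogeneousComponent k (a * g) := by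
    intro g hg
    refine Submodule.span_induction (p := fun g _ => ∀ a d k, (m + 2) * d + δ = γ + k →
      ∃ f, aeval F f = 0 ∧ f.IsHomogeneous d ∧ ψ f = homogeneousComponent k (a * g)) ?_ ?_ ?_ ?_ hg
    · rintro _ ⟨d₀, f, hfd, hf, rfl⟩ a d k hk
      by_cases hlt : (m + 2) * d₀ + δ < γ
      · refine ⟨0, map_zero _, isHomogeneous_zero _ _ _, ?_⟩
        rw [hψ.eq_zero_of_lt d₀ f hf hfd hlt, hψ.map_zero, mul_zero, map_zero]
      · obtain ⟨k₀, hk₀⟩ := Nat.exists_eq_add_of_le (not_lt.1 hlt)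
        have hhom := hψ.isHomogeneous d₀ k₀ f hf hfd hk₀
        rw [mul_comm a]
        by_cases hkk : k < k₀
        · refine ⟨0, map_zero _, isHomogeneous_zero _ _ _, ?_⟩
          rw [homogeneousComponent_mul_of_lt hhom a hkk, hψ.map_zero]
        · obtain ⟨e, rfl⟩ : ∃ e, d = d₀ + e := Nat.exists_eq_add_of_le (by
            by_contra! hlt'
            have := Nat.mul_lt_mul_of_pos_left hlt' (show 0 < m + 2 by omega)
            omega)
          have hk' : k = k₀ + (m + 2) * e := by
            rw [mul_add] at hk; omega
          rw [hk', homogeneousComponent_mul_of_isHomogeneous hhom]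
          obtain ⟨b, hb, hba⟩ := exists_aeval_eq hℓ hℓ1 e
            (homogeneousComponent_isHomogeneous ((m + 2) * e) a)
          refine ⟨b * f, by rw [map_mul, hf, mul_zero], ?_, ?_⟩
          · rw [add_comm]; exact hb.mul hfd
          · rw [hψ.map_mul b f hf, hba, mul_comm]
    · intro a d k _
      exact ⟨0, map_zero _, isHomogeneous_zero _ _ _, by rw [hψ.map_zero, mul_zero, map_zero]⟩
    · intro g g' _ _ h h' a d k hk
      obtain ⟨f, hf, hfd, e⟩ := h a d k hk
      obtain ⟨f', hf', hfd', e'⟩ := h' a d k hk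
      exact ⟨f + f', by rw [map_add, hf, hf', add_zero], hfd.add hfd',
        by rw [hψ.map_add f f' hf hf', e, e', mul_add, map_add]⟩
    · intro b g _ h a d k hk
      obtain ⟨f, hf, hfd, e⟩ := h (a * b) d k hk
      exact ⟨f, hf, hfd, by rw [e, smul_eq_mul, mul_assoc]⟩
  -- This bound makes `k ≥ 2 N`, where the ideal spanned by the values contains all binary forms of
  -- degree `k`.
  refine ⟨γ + 2 * N, fun d hd => ?_⟩
  have hle : d ≤ (m + 2) * d := Nat.le_mul_of_pos_left d (by omega)
  obtain ⟨k, hk⟩ : ∃ k, (m + 2) * d + δ = γ + k := Nat.exists_eq_add_of_le (by omega)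
  refine ⟨k, hk, fun g hg => ?_⟩
  obtain ⟨f, hf, hfd, e⟩ := key g (binaryForms_le_of_X_pow_mem (N := N) (by omega) hN hg) 1 d k hk
  exact ⟨f, hf, hfd, by rw [e, one_mul, homogeneousComponent_eq_self hg]⟩

end Normalization

/-! ### The Hilbert function of a double structure -/

section HilbertFunction

lemma finrank_map_add_finrank_inf_ker {K V W : Type*} [Field K] [AddCommGroup V] [Module K V]
    [AddCommGroup W] [Module K W] (N : Submodule K V) [Module.Finite K N] (q : V →ₗ[K] W) :
    Module.finrank K (N.map q) + Module.finrank K (N ⊓ LinearMap.ker q : Submodule K V)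
      = Module.finrank K N := by
  have h := (q.domRestrict N).finrank_range_add_finrank_ker
  rw [LinearMap.range_domRestrict, LinearMap.ker_domRestrict] at h
  rw [← h, ← (Submodule.comapSubtypeEquivOfLe (inf_le_left (a := N) (b := q.ker))).finrank_eq,
    Submodule.comap_inf, Submodule.comap_subtype_self, top_inf_eq]

variable {K : Type*} [Field K] {n r : ℕ} {F : Fin (n + 1) → MvPolynomial (Fin 2) K}

/-- Two applications of rank-nullity: restriction to the curve contributes the forms of degree `r
d`, and `ψ` on the degree `d` forms vanishing on the curve contributes those of degree `k`. -/
theorem ClosedSubschemeP.hilbertFunction_eq (Y : ClosedSubschemeP K n)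
    (hF : ∀ i, (F i).IsHomogeneous r) (hY : ∀ f ∈ Y.ideal, aeval F f = 0)
    {ψ : CoordRing K n → MvPolynomial (Fin 2) K} (hψ : IsConormalMap F ψ)
    (hker : ∀ f, aeval F f = 0 → (ψ f = 0 ↔ f ∈ Y.ideal)) {d k : ℕ}
    (hdeg : ∀ f, aeval F f = 0 → f.IsHomogeneous d → (ψ f).IsHomogeneous k)
    (hsurj : ∀ g : MvPolynomial (Fin 2) K, g.IsHomogeneous k →
      ∃ f, aeval F f = 0 ∧ f.IsHomogeneous d ∧ ψ f = g)
    (hsurj' : ∀ g : MvPolynomial (Fin 2) K, g.IsHomogeneous (r * d) →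
      ∃ a : CoordRing K n, a.IsHomogeneous d ∧ aeval F a = g) :
    Y.hilbertFunction d = (r * d + 1) + (k + 1) := by
  let N := homogeneousSubmodule (Fin (n + 1)) K d
  have : Module.Finite K N := Module.Finite.iff_fg.2 (homogeneousSubmodule_fg _ _ d)
  let π : CoordRing K n →ₗ[K] MvPolynomial (Fin 2) K := (aeval F).toLinearMap
  let q : CoordRing K n →ₗ[K] CoordRing K n ⧸ Y.ideal := (Ideal.Quotient.mkₐ K Y.ideal).toLinearMap
  have hq : ∀ f, q f = 0 ↔ f ∈ Y.ideal := fun f => Ideal.Quotient.eq_zero_iff_mem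
  let I : Submodule K (CoordRing K n) := N ⊓ LinearMap.ker π
  have hfin : Module.Finite K I := Submodule.finiteDimensional_inf_left _ _
  have hI : ∀ f : I, aeval F (f : CoordRing K n) = 0 := fun f => f.2.2
  let ψL : I →ₗ[K] MvPolynomial (Fin 2) K :=
    { toFun := fun f => ψ f
      map_add' := fun f g => hψ.map_add f g (hI f) (hI g)
      map_smul' := fun c f => hψ.map_smul c (hI f) }
  have h1 := finrank_map_add_finrank_inf_ker N q
  have h2 := finrank_map_add_finrank_inf_ker N π
  have h3 := ψL.finrank_range_add_finrank_ker
  have e2 : N.map π = homogeneousSubmodule (Fin 2) K (r * d) := by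
    apply le_antisymm
    · rintro _ ⟨f, hf, rfl⟩
      exact IsHomogeneous.aeval hf F hF
    · intro g hg
      obtain ⟨a, ha, rfl⟩ := hsurj' g hg
      exact ⟨a, ha, rfl⟩
  have e3 : LinearMap.range ψL = homogeneousSubmodule (Fin 2) K k := by
    apply le_antisymm
    · rintro _ ⟨f, rfl⟩
      exact hdeg f (hI f) f.2.1
    · intro g hg
      obtain ⟨f, hf, hfd, rfl⟩ := hsurj g hg
      exact ⟨⟨f, hfd, hf⟩, rfl⟩
  have hle : N ⊓ LinearMap.ker q ≤ I := fun f hf => ⟨hf.1, hY f ((hq f).1 hf.2)⟩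
  have e4 : LinearMap.ker ψL = (N ⊓ LinearMap.ker q).comap I.subtype := by
    ext f
    exact (hker f (hI f)).trans ⟨fun h => ⟨f.2.1, (hq f).2 h⟩, fun h => (hq f).1 h.2⟩
  rw [e3, finrank_binaryForms, e4, (Submodule.comapSubtypeEquivOfLe hle).finrank_eq] at h3
  rw [e2, finrank_binaryForms] at h2
  have h5 : Y.hilbertFunction d = Module.finrank K (N.map q) := rfl
  have h6 : Module.finrank K I = Module.finrank K (N ⊓ LinearMap.ker π : Submodule _ _) := rfl
  omega

end HilbertFunction

/-! ### Genus one double structures and their projective equivalence -/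

section Classification

variable {K : Type*} [Field K]

/-- The parametrized forms `(F_i, G_i)` give coordinates on the space of pairs of binary forms of
degrees `r` and `r - 2`. -/
structure IsDoubledParametrization {n : ℕ} (m : ℕ) (F G : Fin (n + 1) → MvPolynomial (Fin 2) K) :
    Prop where
  isHomogeneous_fst : ∀ i, (F i).IsHomogeneous (m + 2)
  isHomogeneous_snd : ∀ i, (G i).IsHomogeneous m
  linearIndependent : LinearIndependent K fun i => (F i, G i)

/-- The genus determines the degree of the line bundle. -/
lemma genus_one_shift {Y : ℕ → ℕ} {m δ γ : ℕ} (d₁ : ℕ)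
    (h : ∀ d ≥ d₁, ∃ k, (m + 2) * d + δ = γ + k ∧ Y d = ((m + 2) * d + 1) + (k + 1))
    (hg : ∃ D : ℤ, ∃ j₀ : ℕ, ∀ j : ℕ, j₀ ≤ j →
      (Polynomial.C (D : ℚ) * Polynomial.X + Polynomial.C (1 - ((1 : ℤ) : ℚ))).eval (j : ℚ)
        = (Y j : ℚ)) : γ = δ + 2 := by
  obtain ⟨D, j₀, hD⟩ := hg
  have key : ∀ j ≥ max d₁ j₀, D * j = 2 * ((m + 2) * j) + 2 + δ - γ := by
    intro j hj
    obtain ⟨k, hk, hY⟩ := h j (le_trans (le_max_left _ _) hj)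
    have h1 := hD j (le_trans (le_max_right _ _) hj)
    rw [hY] at h1
    simp only [Polynomial.eval_add, Polynomial.eval_mul, Polynomial.eval_C, Polynomial.eval_X,
      Int.cast_one, sub_self, add_zero] at h1
    have h2 : D * j = (((m + 2) * j + 1) + (k + 1) : ℕ) := by exact_mod_cast h1
    have h3 : ((m + 2) * j + δ : ℤ) = γ + k := by exact_mod_cast hk
    push_cast at h2
    linarith
  set J := max d₁ j₀
  have a1 := key J le_rfl
  have a2 := key (J + 1) (by omega)
  push_cast at a2
  have hDm : D = 2 * (m + 2) := by linarith
  rw [hDm] at a1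
  have : (γ : ℤ) = δ + 2 := by linarith
  exact_mod_cast this

lemma exists_ne_zero_of_aeval_eq {σ : Type*} {m : ℕ} {F : σ → MvPolynomial (Fin 2) K}
    {ℓ : ℕ → MvPolynomial σ K} (hℓ : ∀ j ≤ m + 2, aeval F (ℓ j) = X 0 ^ (m + 2 - j) * X 1 ^ j)
    (hℓ1 : ∀ j, (ℓ j).IsHomogeneous 1) : ∃ i, F i ≠ 0 := by
  by_contra! h
  have h0 := hℓ 0 (by omega)
  have h1 : aeval F (ℓ 0) = 0 := by
    have := aeval_mul_of_isHomogeneous (hℓ1 0) (0 : MvPolynomial (Fin 2) K) F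
    simp only [zero_mul, pow_one] at this
    rwa [show (fun _ => 0) = F from funext fun i => (h i).symm] at this
  rw [h1] at h0
  exact mul_ne_zero (pow_ne_zero _ (X_ne_zero _)) (pow_ne_zero _ (X_ne_zero _)) h0.symm

/-- Every non-degenerate double structure of arithmetic genus one on a rational normal curve is the
image of a first order thickening of the parametrization. -/
theorem IsDoubleStructure.exists_doubledParametrization [IsAlgClosed K] [CharZero K] {n m : ℕ}
    {C Y : ClosedSubschemeP K n} {F : Fin (n + 1) → MvPolynomial (Fin 2) K}
    (hF : ∀ i, (F i).IsHomogeneous (m + 2)) (hCF : ∀ f, f ∈ C.ideal ↔ aeval F f = 0)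
    {ℓ : ℕ → CoordRing K n} (hℓ : ∀ j ≤ m + 2, aeval F (ℓ j) = X 0 ^ (m + 2 - j) * X 1 ^ j)
    (hℓ1 : ∀ j, (ℓ j).IsHomogeneous 1)
    (hD : IsDoubleStructure C Y) (hnd : Y.IsNondegenerate) (hg : Y.HasArithmeticGenus 1) :
    ∃ G, IsDoubledParametrization m F G ∧ ∀ f, f ∈ Y.ideal ↔ firstOrder F G f = 0 := by
  obtain ⟨i, hi⟩ := exists_ne_zero_of_aeval_eq hℓ hℓ1
  obtain ⟨ψ₀, δ₀, hψ₀, hker₀, hdeg₀, hne₀⟩ := hD.exists_conormalMap hF hCF hi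
  obtain ⟨ψ, γ, hψ, hker, hpt⟩ := hψ₀.exists_normalization (δ := (m + 2) * δ₀) (by omega) hF
    (fun d f hf hfd => by rw [← mul_add]; exact hdeg₀ d f hf hfd) hne₀
  have hker' : ∀ f, aeval F f = 0 → (ψ f = 0 ↔ f ∈ Y.ideal) :=
    fun f hf => (hker f hf).trans (hker₀ f hf)
  have hY : ∀ f ∈ Y.ideal, aeval F f = 0 := fun f hf => (hCF f).1 (hD.2.1 hf)
  obtain ⟨d₁, hd₁⟩ := hψ.exists_eq_of_large hℓ hℓ1 hpt
  -- The conormal map has total shift `-2`, exactly the case that integrates to a thickening.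
  have hγ : γ = (m + 2) * δ₀ + 2 := by
    refine genus_one_shift (Y := Y.hilbertFunction) (m := m) d₁ (fun d hd => ?_) hg
    obtain ⟨k, hk, hsurj⟩ := hd₁ d hd
    exact ⟨k, hk, Y.hilbertFunction_eq hF hY hψ.toIsConormalMap hker'
      (fun f hf hfd => hψ.isHomogeneous d k f hf hfd hk) hsurj
      fun g hg => exists_aeval_eq hℓ hℓ1 d hg⟩
  obtain ⟨G, hG, hψG⟩ := hψ.exists_firstOrder hF hℓ hℓ1 fun d f hf hfd =>
    hψ.isHomogeneous (d + 1) _ f hf hfd (by rw [hγ]; ring)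
  have hYG : ∀ f, f ∈ Y.ideal ↔ firstOrder F G f = 0 := by
    intro f
    rw [TrivSqZeroExt.ext_iff, fst_firstOrder, TrivSqZeroExt.fst_zero, TrivSqZeroExt.snd_zero]
    constructor
    · intro hf
      have h0 := hY f hf
      exact ⟨h0, by rw [← hψG f h0]; exact (hker' f h0).2 hf⟩
    · rintro ⟨h0, h1⟩
      rw [← hψG f h0] at h1
      exact (hker' f h0).1 h1
  refine ⟨G, ⟨hF, hG, ?_⟩, hYG⟩
  rw [Fintype.linearIndependent_iff]
  intro c hc
  -- A linear relation among the pairs `(F_i, G_i)` is a hyperplane containing `Y`.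
  have h1 : (∑ i, MvPolynomial.C (c i) * X i : CoordRing K n) = 0 := by
    refine hnd _ ?_ ((hYG _).2 ?_)
    · exact IsHomogeneous.sum _ _ _ fun i _ => isHomogeneous_C_mul_X _ _
    · rw [map_sum, TrivSqZeroExt.ext_iff]
      rw [Prod.ext_iff] at hc
      simp only [← MvPolynomial.smul_eq_C_mul, map_smul, TrivSqZeroExt.fst_sum,
        TrivSqZeroExt.snd_sum, TrivSqZeroExt.fst_smul, TrivSqZeroExt.snd_smul, fst_firstOrder,
        snd_firstOrder_X, aeval_X, Prod.fst_sum, Prod.snd_sum, Prod.smul_fst, Prod.smul_snd] at hc ⊢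
      exact hc
  intro i
  have h2 := congrArg (coeff (Finsupp.single i 1)) h1
  rw [coeff_sum] at h2
  simpa [coeff_C_mul, MvPolynomial.coeff_X, Finsupp.single_left_inj] using h2

/-- Two doubled parametrizations with the same underlying parametrization differ by a linear
change of coordinates. -/
theorem projectivelyEquivalent_of_doubledParametrization {n m : ℕ} (hn : n + 1 = 2 * (m + 2))
    {Y Z : ClosedSubschemeP K n} {F G H : Fin (n + 1) → MvPolynomial (Fin 2) K}
    (hG : IsDoubledParametrization m F G) (hH : IsDoubledParametrization m F H)
    (hY : ∀ f, f ∈ Y.ideal ↔ firstOrder F G f = 0)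
    (hZ : ∀ f, f ∈ Z.ideal ↔ firstOrder F H f = 0) : ProjectivelyEquivalent Y Z := by
  let V := homogeneousSubmodule (Fin 2) K (m + 2)
  let W := homogeneousSubmodule (Fin 2) K m
  let v : ∀ {G}, IsDoubledParametrization m F G → Fin (n + 1) → V × W :=
    fun {G} hG i => (⟨F i, hG.isHomogeneous_fst i⟩, ⟨G i, hG.isHomogeneous_snd i⟩)
  have hv : ∀ {G} (hG : IsDoubledParametrization m F G), LinearIndependent K (v hG) := by
    intro G hG
    exact LinearIndependent.of_comp (V.subtype.prodMap W.subtype) hG.linearIndependent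
  have hcard : Fintype.card (Fin (n + 1)) = Module.finrank K (V × W) := by
    rw [Module.finrank_prod, finrank_binaryForms, finrank_binaryForms, Fintype.card_fin]
    omega
  let b : ∀ {G} (_ : IsDoubledParametrization m F G), Module.Basis (Fin (n + 1)) K (V × W) :=
    fun hG => basisOfLinearIndependentOfCardEqFinrank (hv hG) hcard
  have hb : ∀ {G} (hG : IsDoubledParametrization m F G) i, b hG i = v hG i := by
    intro G hG i
    simp [b]
  -- Transposed because `linearSubst` reads coefficients along rows, whereas `toMatrix` puts
  -- coordinates in columns.
  let M : Matrix (Fin (n + 1)) (Fin (n + 1)) K := ((b hG).toMatrix (b hH)).transpose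
  let M' : Matrix (Fin (n + 1)) (Fin (n + 1)) K := ((b hH).toMatrix (b hG)).transpose
  have hMM' : M * M' = 1 := by
    rw [← Matrix.transpose_mul, Module.Basis.toMatrix_mul_toMatrix_flip, Matrix.transpose_one]
  have hM'M : M' * M = 1 := by
    rw [← Matrix.transpose_mul, Module.Basis.toMatrix_mul_toMatrix_flip, Matrix.transpose_one]
  refine ⟨⟨M, M', hMM', hM'M⟩, ?_⟩
  have key : (firstOrder F G).comp (linearSubst ⟨M, M', hMM', hM'M⟩) = firstOrder F H := by
    refine algHom_ext fun i => ?_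
    have h1 : ∑ j, M i j • v hG j = v hH i := by
      refine Eq.trans (Finset.sum_congr rfl fun j _ => ?_)
        (((b hG).sum_repr (b hH i)).trans (hb hH i))
      rw [hb hG]
      rfl
    rw [Prod.ext_iff] at h1
    have h2 := congrArg Subtype.val h1.1
    have h3 := congrArg Subtype.val h1.2
    rw [AlgHom.comp_apply, linearSubst, aeval_X, map_sum, TrivSqZeroExt.ext_iff]
    simp only [← MvPolynomial.smul_eq_C_mul, map_smul, TrivSqZeroExt.fst_sum,
      TrivSqZeroExt.snd_sum, TrivSqZeroExt.fst_smul, TrivSqZeroExt.snd_smul, fst_firstOrder,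
      snd_firstOrder_X, aeval_X, Prod.fst_sum, Prod.snd_sum, Prod.smul_fst, Prod.smul_snd,
      Submodule.coe_sum, Submodule.coe_smul] at h2 h3 ⊢
    exact ⟨h2, h3⟩
  ext f
  rw [hZ, Ideal.mem_comap, hY, ← key]
  rfl

end Classification

/-! ### Degrees in a first order thickening -/

section FirstOrderGrading

variable {K σ : Type*} [Field K] {m : ℕ} {F G : σ → MvPolynomial (Fin 2) K}

lemma firstOrder_eq_zero_iff (f : MvPolynomial σ K) :
    firstOrder F G f = 0 ↔ aeval F f = 0 ∧ (firstOrder F G f).snd = 0 := by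
  rw [TrivSqZeroExt.ext_iff, fst_firstOrder, TrivSqZeroExt.fst_zero, TrivSqZeroExt.snd_zero]

lemma snd_firstOrder_of_isHomogeneous_zero {f : MvPolynomial σ K} (hf : f.IsHomogeneous 0) :
    (firstOrder F G f).snd = 0 := by
  rw [totalDegree_eq_zero_iff_eq_C.1 ((totalDegree_zero_iff_isHomogeneous _).2 hf), firstOrder,
    aeval_C]
  rfl

lemma isHomogeneous_snd_firstOrder (hF : ∀ i, (F i).IsHomogeneous (m + 2))
    (hG : ∀ i, (G i).IsHomogeneous m) (d : ℕ) {f : MvPolynomial σ K}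
    (hf : f.IsHomogeneous (d + 1)) :
    ((firstOrder F G f).snd).IsHomogeneous ((m + 2) * d + m) := by
  have h1 : ∀ g : MvPolynomial σ K, g.IsHomogeneous 1 →
      ((firstOrder F G g).snd).IsHomogeneous m := by
    intro g hg
    have hg' : g ∈ Submodule.span K (Set.range X) := by
      rw [← homogeneousSubmodule_one_eq_span_X]; exact hg
    refine Submodule.span_induction (p := fun g _ => ((firstOrder F G g).snd).IsHomogeneous m)
      ?_ ?_ ?_ ?_ hg'
    · rintro _ ⟨i, rfl⟩
      rw [snd_firstOrder_X]
      exact hG i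
    · rw [map_zero]
      exact isHomogeneous_zero _ _ _
    · intro g h _ _ hg hh
      rw [snd_firstOrder_add]
      exact hg.add hh
    · intro c g _ hg
      rw [snd_firstOrder_smul]
      exact Submodule.smul_mem (homogeneousSubmodule _ K m) c hg
  induction d generalizing f with
  | zero => simpa using h1 f hf
  | succ d ih =>
    have hmem : f ∈ homogeneousSubmodule σ K (d + 1) * homogeneousSubmodule σ K 1 := by
      rw [← homogeneousSubmodule_one_pow (σ := σ) (R := K) (d + 1), ← pow_succ,
        homogeneousSubmodule_one_pow]
      exact hf
    refine Submodule.mul_induction_on hmem (fun g hg h hh => ?_) fun g h hg hh => ?_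
    · rw [snd_firstOrder_mul]
      refine IsHomogeneous.add ?_ ?_
      · convert (IsHomogeneous.aeval hg F hF).mul (h1 h hh) using 1
      · convert (IsHomogeneous.aeval hh F hF).mul (ih hg) using 1
        ring
    · rw [snd_firstOrder_add]
      exact hg.add hh

lemma homogeneousComponent_snd_firstOrder (hF : ∀ i, (F i).IsHomogeneous (m + 2))
    (hG : ∀ i, (G i).IsHomogeneous m) (d : ℕ) (f : MvPolynomial σ K) :
    homogeneousComponent ((m + 2) * d + m) (firstOrder F G f).snd
      = (firstOrder F G (homogeneousComponent (d + 1) f)).snd := by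
  have key : ∀ i, homogeneousComponent ((m + 2) * d + m)
      (firstOrder F G (homogeneousComponent i f)).snd
      = if i = d + 1 then (firstOrder F G (homogeneousComponent (d + 1) f)).snd else 0 := by
    intro i
    rcases i with _ | i
    · rw [snd_firstOrder_of_isHomogeneous_zero (homogeneousComponent_isHomogeneous 0 f), map_zero,
        if_neg (by omega)]
    · rw [homogeneousComponent_of_mem (isHomogeneous_snd_firstOrder hF hG i
        (homogeneousComponent_isHomogeneous (i + 1) f))]
      by_cases h : i = d
      · subst h; simp
      · rw [if_neg, if_neg (by omega)]
        intro h'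
        exact h (Nat.eq_of_mul_eq_mul_left (show 0 < m + 2 by omega) (Nat.add_right_cancel h')).symm
  conv_lhs => rw [← sum_homogeneousComponent f, map_sum, TrivSqZeroExt.snd_sum, map_sum]
  simp only [key, Finset.sum_ite_eq', Finset.mem_range]
  split_ifs with h1
  · rfl
  · rw [homogeneousComponent_eq_zero _ _ (by omega), map_zero, TrivSqZeroExt.snd_zero]

end FirstOrderGrading

/-! ### Construction of a genus one double structure -/

section Existence

variable {K : Type*} [Field K] {n m : ℕ} {F G : Fin (n + 1) → MvPolynomial (Fin 2) K}

/-- The image of a doubled parametrization. -/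
noncomputable def doubledScheme (hFG : IsDoubledParametrization m F G)
    (hF0 : ∃ i, F i ≠ 0) : ClosedSubschemeP K n where
  ideal := RingHom.ker (firstOrder F G)
  homogeneous := by
    intro d f hf
    rw [show (DirectSum.decompose (homogeneousSubmodule (Fin (n + 1)) K) f d : CoordRing K n)
      = homogeneousComponent d f from decomposition.decompose'_apply f d]
    rw [RingHom.mem_ker, firstOrder_eq_zero_iff] at hf ⊢
    refine ⟨aeval_homogeneousComponent_eq_zero (by omega) hFG.isHomogeneous_fst hf.1 d, ?_⟩
    rcases d with _ | d
    · exact snd_firstOrder_of_isHomogeneous_zero (homogeneousComponent_isHomogeneous 0 f)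
    · rw [← homogeneousComponent_snd_firstOrder hFG.isHomogeneous_fst hFG.isHomogeneous_snd, hf.2,
        map_zero]
  saturated := by
    intro f hf
    obtain ⟨i, hi⟩ := hF0
    obtain ⟨k, hk⟩ := hf i
    rw [RingHom.mem_ker, firstOrder_eq_zero_iff] at hk ⊢
    have h0 : aeval F f = 0 := by
      have := hk.1
      rw [map_mul, map_pow, aeval_X] at this
      exact (mul_eq_zero.1 this).resolve_left (pow_ne_zero _ hi)
    refine ⟨h0, ?_⟩
    have := hk.2
    rw [snd_firstOrder_mul, h0, zero_mul, add_zero, map_pow, aeval_X] at this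
    exact (mul_eq_zero.1 this).resolve_left (pow_ne_zero _ hi)

lemma mem_doubledScheme (hFG : IsDoubledParametrization m F G) (hF0 : ∃ i, F i ≠ 0)
    (f : CoordRing K n) : f ∈ (doubledScheme hFG hF0).ideal ↔
      aeval F f = 0 ∧ (firstOrder F G f).snd = 0 :=
  RingHom.mem_ker.trans (firstOrder_eq_zero_iff f)

lemma doubledScheme_isNondegenerate (hFG : IsDoubledParametrization m F G)
    (hF0 : ∃ i, F i ≠ 0) : (doubledScheme hFG hF0).IsNondegenerate := by
  intro l hl hlY
  rw [mem_doubledScheme] at hlY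
  have hl' : l ∈ Submodule.span K (Set.range X) := by
    rw [← homogeneousSubmodule_one_eq_span_X]; exact hl
  obtain ⟨c, rfl⟩ := (Submodule.mem_span_range_iff_exists_fun K).1 hl'
  have hc : ∑ i, c i • (F i, G i) = 0 := by
    rw [Prod.ext_iff]
    simpa only [map_sum, map_smul, TrivSqZeroExt.snd_sum, TrivSqZeroExt.snd_smul,
      snd_firstOrder_X, aeval_X, Prod.fst_sum, Prod.snd_sum, Prod.smul_fst, Prod.smul_snd,
      Prod.fst_zero, Prod.snd_zero] using hlY
  have h0 := Fintype.linearIndependent_iff.1 hFG.linearIndependent c hc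
  simp [h0]

/-- The binary forms of degree `m` are the values of the thickening on linear forms vanishing on
the curve. -/
lemma IsDoubledParametrization.exists_linear_eq (hFG : IsDoubledParametrization m F G)
    (hn : n + 1 = 2 * (m + 2)) {g : MvPolynomial (Fin 2) K} (hg : g.IsHomogeneous m) :
    ∃ y : CoordRing K n, y.IsHomogeneous 1 ∧ aeval F y = 0 ∧ (firstOrder F G y).snd = g := by
  let V := homogeneousSubmodule (Fin 2) K (m + 2)
  let W := homogeneousSubmodule (Fin 2) K m
  let v : Fin (n + 1) → V × W :=
    fun i => (⟨F i, hFG.isHomogeneous_fst i⟩, ⟨G i, hFG.isHomogeneous_snd i⟩)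
  have hv : LinearIndependent K v :=
    LinearIndependent.of_comp (V.subtype.prodMap W.subtype) hFG.linearIndependent
  have hspan : Submodule.span K (Set.range v) = ⊤ := by
    refine hv.span_eq_top_of_card_eq_finrank' ?_
    rw [Module.finrank_prod, finrank_binaryForms, finrank_binaryForms, Fintype.card_fin]
    omega
  obtain ⟨c, hc⟩ := (Submodule.mem_span_range_iff_exists_fun K).1
    (show ((0, ⟨g, hg⟩) : V × W) ∈ Submodule.span K (Set.range v) by rw [hspan]; trivial)
  rw [Prod.ext_iff] at hc
  have h2 := congrArg Subtype.val hc.1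
  have h3 := congrArg Subtype.val hc.2
  simp only [v, Prod.fst_sum, Prod.snd_sum, Prod.smul_fst, Prod.smul_snd,
    Submodule.coe_sum, Submodule.coe_smul, ZeroMemClass.coe_zero] at h2 h3
  refine ⟨∑ i, c i • X i, ?_, ?_, ?_⟩
  · exact Submodule.sum_mem (homogeneousSubmodule _ K 1) fun i _ =>
      Submodule.smul_mem _ _ (isHomogeneous_X _ _)
  · simpa only [map_sum, map_smul, aeval_X] using h2
  · simpa only [map_sum, map_smul, TrivSqZeroExt.snd_sum, TrivSqZeroExt.snd_smul,
      snd_firstOrder_X] using h3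

/-- A form of degree `(m + 2) d + m` is a sum of products of forms of degrees `(m + 2) d` and `m`.
The first factor lifts to an ambient form, the second to a linear form vanishing on the curve, so
here surjectivity holds from degree one on. -/
lemma IsDoubledParametrization.exists_eq (hFG : IsDoubledParametrization m F G)
    (hn : n + 1 = 2 * (m + 2)) {ℓ : ℕ → CoordRing K n}
    (hℓ : ∀ j ≤ m + 2, aeval F (ℓ j) = X 0 ^ (m + 2 - j) * X 1 ^ j)
    (hℓ1 : ∀ j, (ℓ j).IsHomogeneous 1) (d : ℕ) {g : MvPolynomial (Fin 2) K}
    (hg : g.IsHomogeneous ((m + 2) * d + m)) :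
    ∃ f, aeval F f = 0 ∧ f.IsHomogeneous (d + 1) ∧ (firstOrder F G f).snd = g := by
  let D : CoordRing K n →ₗ[K] MvPolynomial (Fin 2) K :=
    { toFun := fun f => (firstOrder F G f).snd
      map_add' := snd_firstOrder_add
      map_smul' := snd_firstOrder_smul }
  let N : Submodule K (CoordRing K n) :=
    LinearMap.ker (aeval F).toLinearMap ⊓ homogeneousSubmodule _ K (d + 1)
  have key : homogeneousSubmodule (Fin 2) K ((m + 2) * d + m) ≤ N.map D := by
    refine binaryForms_add_le _ _ _ fun p q hp hq => ?_
    obtain ⟨a, ha, rfl⟩ := exists_aeval_eq hℓ hℓ1 d hp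
    obtain ⟨y, hy, hy0, rfl⟩ := hFG.exists_linear_eq hn hq
    refine ⟨a * y, ⟨?_, ha.mul hy⟩, ?_⟩
    · simp only [SetLike.mem_coe, LinearMap.mem_ker, AlgHom.toLinearMap_apply]
      rw [map_mul, hy0, mul_zero]
    · change (firstOrder F G (a * y)).snd = _
      rw [snd_firstOrder_mul, hy0, zero_mul, add_zero]
  obtain ⟨f, hf, rfl⟩ := key hg
  exact ⟨f, hf.1, hf.2, rfl⟩

lemma doubledScheme_hasArithmeticGenus (hFG : IsDoubledParametrization m F G)
    (hF0 : ∃ i, F i ≠ 0) (hn : n + 1 = 2 * (m + 2)) {ℓ : ℕ → CoordRing K n}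
    (hℓ : ∀ j ≤ m + 2, aeval F (ℓ j) = X 0 ^ (m + 2 - j) * X 1 ^ j)
    (hℓ1 : ∀ j, (ℓ j).IsHomogeneous 1) : (doubledScheme hFG hF0).HasArithmeticGenus 1 := by
  refine ⟨2 * (m + 2), 1, fun j hj => ?_⟩
  obtain ⟨d, rfl⟩ := Nat.exists_eq_add_of_le' hj
  rw [(doubledScheme hFG hF0).hilbertFunction_eq (r := m + 2) (k := (m + 2) * d + m)
    hFG.isHomogeneous_fst (fun f hf => ((mem_doubledScheme hFG hF0 f).1 hf).1)
    (isConormalMap_firstOrder (G := G))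
    (fun f hf => by rw [mem_doubledScheme]; exact ⟨fun h => ⟨hf, h⟩, fun h => h.2⟩)
    (fun f _ hfd => isHomogeneous_snd_firstOrder hFG.isHomogeneous_fst hFG.isHomogeneous_snd d hfd)
    (fun g hg => hFG.exists_eq hn hℓ hℓ1 d hg) fun g hg => exists_aeval_eq hℓ hℓ1 _ hg]
  simp
  ring

/-- Every binary form of positive degree over an algebraically closed field has a linear factor. -/
lemma exists_linear_factor [IsAlgClosed K] {k : ℕ} {f : MvPolynomial (Fin 2) K}
    (hf : f.IsHomogeneous (k + 1)) (hf0 : f ≠ 0) :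
    ∃ g h : MvPolynomial (Fin 2) K, g.IsHomogeneous 1 ∧ h.IsHomogeneous k ∧ f = g * h := by
  obtain ⟨p, hp, hfp⟩ : ∃ p : Fin 2 → K, p ≠ 0 ∧ eval p f = 0 := by
    by_contra! h
    -- Without zeros, `f` would divide powers of both coordinates and thus be a unit, which positive
    -- degree excludes.
    obtain ⟨N, hN⟩ := exists_X_pow_mem (𝔟 := Ideal.span {f}) fun p hp =>
      ⟨f, Ideal.mem_span_singleton_self f, h p hp⟩
    simp only [Ideal.mem_span_singleton] at hN
    obtain ⟨j, -, hj⟩ := (dvd_prime_pow X_prime N).1 (hN 0)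
    have hfu : IsUnit f := by
      rcases j with _ | j
      · rw [pow_zero] at hj
        exact (associated_one_iff_isUnit).1 hj
      · exact absurd (((dvd_pow_self _ (Nat.succ_ne_zero j)).trans hj.symm.dvd).trans (hN 1))
          (not_X_zero_dvd_X_one_pow N)
    obtain ⟨u, hu⟩ := hfu.exists_right_inv
    have := eq_zero_of_isHomogeneous_mul_of_lt hf hf0 (k := 0) (h := u)
      (by rw [hu]; exact isHomogeneous_one _ _) (by omega)
    rw [this, mul_zero] at hu
    exact zero_ne_one hu
  obtain ⟨h, rfl⟩ := linear_dvd_of_eval_eq_zero hf hp hfp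
  refine ⟨_, h, isHomogeneous_linear p, ?_, rfl⟩
  refine isHomogeneous_of_mul_left (isHomogeneous_linear p) (linear_ne_zero hp) ?_
  rwa [add_comm]

lemma doubledScheme_isDoubleStructure [IsAlgClosed K] (hFG : IsDoubledParametrization m F G)
    (hF0 : ∃ i, F i ≠ 0) (hn : n + 1 = 2 * (m + 2)) {ℓ : ℕ → CoordRing K n}
    (hℓ : ∀ j ≤ m + 2, aeval F (ℓ j) = X 0 ^ (m + 2 - j) * X 1 ^ j)
    (hℓ1 : ∀ j, (ℓ j).IsHomogeneous 1) {C : ClosedSubschemeP K n}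
    (hCF : ∀ f, f ∈ C.ideal ↔ aeval F f = 0) : IsDoubleStructure C (doubledScheme hFG hF0) := by
  set Y := doubledScheme hFG hF0
  have hY : ∀ f, f ∈ Y.ideal ↔ aeval F f = 0 ∧ (firstOrder F G f).snd = 0 :=
    mem_doubledScheme hFG hF0
  have hsq : C.ideal ^ 2 ≤ Y.ideal := by
    rw [pow_two, Ideal.mul_le]
    intro f hf g hg
    rw [hCF] at hf hg
    rw [hY, map_mul, snd_firstOrder_mul, hf, hg]
    simp
  refine ⟨hsq, fun f hf => (hCF f).2 ((hY f).1 hf).1, fun i => ?_⟩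
  by_cases hi : F i = 0
  · exact invertible_conormalQuotient_of_eq_top
      (chartIdeal_eq_top ((hCF _).2 (by rw [aeval_X]; exact hi))) (chartIdeal_sq_le hsq)
  have hC : C.ideal.IsPrime := by
    have : C.ideal = RingHom.ker (aeval F : CoordRing K n →ₐ[K] MvPolynomial (Fin 2) K) := by
      ext f; exact hCF f
    rw [this]
    exact RingHom.ker_isPrime _
  have hiC : X i ∉ C.ideal := by rw [hCF, aeval_X]; exact hi
  -- A quadric `e` with value `b²`, of degree `2 (m + 1) = (m + 2) + m`, generates the line bundle
  -- on this chart, since `b` divides `F_i` and so has no zeros there.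
  obtain ⟨a, b, ha, hb, hab⟩ := exists_linear_factor (hFG.isHomogeneous_fst i) hi
  have hb0 : b ≠ 0 := by
    rintro rfl
    exact hi (by rw [hab, mul_zero])
  obtain ⟨e, he, hed, hDE⟩ := hFG.exists_eq hn hℓ hℓ1 1 (g := b ^ 2) (by
    convert hb.pow 2 using 1; ring)
  refine invertible_conormalQuotient_of_generator (chartIdeal_sq_le hsq)
    (e := chartFrac i 2 e hed) ?_ ?_ ?_
  · rw [chartFrac_mem_chartIdeal_of_isPrime hC hiC, hCF]
    exact he
  · intro z hz
    obtain ⟨d, c, hc, rfl⟩ := exists_chartFrac z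
    rw [chartFrac_mul, chartFrac_mem_chartIdeal] at hz
    rw [chartFrac_mem_chartIdeal_of_isPrime hC hiC, hCF]
    obtain ⟨k, hk⟩ := hz
    have h1 := ((hY _).1 hk).2
    rw [← mul_assoc, snd_firstOrder_mul, he, zero_mul, add_zero, hDE, map_mul, map_pow,
      aeval_X] at h1
    have h2 := (mul_eq_zero.1 h1).resolve_right (pow_ne_zero _ hb0)
    exact (mul_eq_zero.1 h2).resolve_left (pow_ne_zero _ hi)
  · intro z hz
    obtain ⟨d, f, hf, rfl⟩ := exists_chartFrac z
    rw [chartFrac_mem_chartIdeal_of_isPrime hC hiC, hCF] at hz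
    -- The coefficient must satisfy `F_i² ψ(f) = c b²`, that is `c = a² ψ(f)` on the curve. The
    -- factor `a²` raises the degree to a multiple of `m + 2`, so `c` lifts.
    obtain ⟨c, hc, hcD⟩ : ∃ c : CoordRing K n, c.IsHomogeneous d ∧
        aeval F c = a ^ 2 * (firstOrder F G f).snd := by
      refine exists_aeval_eq hℓ hℓ1 d ?_
      rcases d with _ | d
      · rw [snd_firstOrder_of_isHomogeneous_zero hf, mul_zero]
        exact isHomogeneous_zero _ _ _
      · convert (ha.pow 2).mul
          (isHomogeneous_snd_firstOrder hFG.isHomogeneous_fst hFG.isHomogeneous_snd d hf) using 1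
        ring
    refine ⟨chartFrac i d c hc, ?_⟩
    have hpad : (X i ^ 2 * f).IsHomogeneous (d + 2) := by
      rw [add_comm d]; exact (isHomogeneous_X_pow i 2).mul hf
    rw [chartFrac_mul, chartFrac_eq_of_eq_X_pow_mul hf hpad 2 (add_comm _ _) rfl, chartFrac_sub,
      chartFrac_mem_chartIdeal]
    refine ⟨0, ?_⟩
    rw [pow_zero, one_mul, hY]
    constructor
    · rw [map_sub, map_mul, map_mul, hz, he, mul_zero, mul_zero, sub_zero]
    · rw [snd_firstOrder_sub, snd_firstOrder_mul, snd_firstOrder_mul, hz, he, hDE, hcD, map_pow,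
        aeval_X, hab]
      ring

/-- A parametrization spanning the forms of degree `m + 2` in `2 (m + 2)` variables extends to a
doubled parametrization. -/
lemma exists_isDoubledParametrization (hn : n + 1 = 2 * (m + 2))
    (hF : ∀ i, (F i).IsHomogeneous (m + 2)) {ℓ : ℕ → CoordRing K n}
    (hℓ : ∀ j ≤ m + 2, aeval F (ℓ j) = X 0 ^ (m + 2 - j) * X 1 ^ j)
    (hℓ1 : ∀ j, (ℓ j).IsHomogeneous 1) : ∃ G, IsDoubledParametrization m F G := by
  let A : (Fin (n + 1) → K) →ₗ[K] MvPolynomial (Fin 2) K := Fintype.linearCombination K F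
  have hrange : LinearMap.range A = homogeneousSubmodule (Fin 2) K (m + 2) := by
    rw [Fintype.range_linearCombination]
    apply le_antisymm
    · rw [Submodule.span_le]
      rintro _ ⟨i, rfl⟩
      exact hF i
    · refine binaryForms_le _ fun a b hab => ?_
      have h1 : ℓ b ∈ Submodule.span K (Set.range X) := by
        rw [← homogeneousSubmodule_one_eq_span_X]; exact hℓ1 b
      obtain ⟨c, hc⟩ := (Submodule.mem_span_range_iff_exists_fun K).1 h1
      refine (Submodule.mem_span_range_iff_exists_fun K).2 ⟨c, ?_⟩
      have h2 := hℓ b (by omega)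
      rw [← hc, map_sum] at h2
      simp only [map_smul, aeval_X] at h2
      rw [h2]
      congr
      omega
  have hker : Module.finrank K (LinearMap.ker A)
      = Module.finrank K (homogeneousSubmodule (Fin 2) K m) := by
    have := A.finrank_range_add_finrank_ker
    rw [hrange, finrank_binaryForms, Module.finrank_fintype_fun_eq_card, Fintype.card_fin] at this
    rw [finrank_binaryForms]
    omega
  -- The kernel of `A` has the dimension `m + 1` of the forms of degree `m`. Projecting onto it and
  -- identifying the two spaces gives a map `B` injective on that kernel, so `(A, B)` is injective.
  obtain ⟨p, hp⟩ := (LinearMap.ker A).subtype.exists_leftInverse_of_injective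
    (Submodule.ker_subtype _)
  let e := LinearEquiv.ofFinrankEq _ _ hker
  let B : (Fin (n + 1) → K) →ₗ[K] MvPolynomial (Fin 2) K :=
    (homogeneousSubmodule (Fin 2) K m).subtype ∘ₗ e.toLinearMap ∘ₗ p
  refine ⟨fun i => B (Pi.single i 1), hF, fun i => (e (p (Pi.single i 1))).2, ?_⟩
  rw [Fintype.linearIndependent_iff]
  intro c hc
  rw [Prod.ext_iff] at hc
  simp only [Prod.fst_sum, Prod.snd_sum, Prod.smul_fst, Prod.smul_snd, Prod.fst_zero,
    Prod.snd_zero] at hc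
  have hcA : c ∈ LinearMap.ker A := hc.1
  have hcB : B c = 0 := by
    rw [← hc.2]
    conv_lhs => rw [pi_eq_sum_univ' c]
    rw [map_sum]
    refine Finset.sum_congr rfl fun i _ => ?_
    rw [map_smul]
  have hpc : p c = 0 := by
    have h1 : e (p c) = 0 := Subtype.ext hcB
    exact (LinearEquiv.map_eq_zero_iff e).1 h1
  have h2 : p c = ⟨c, hcA⟩ := LinearMap.congr_fun hp ⟨c, hcA⟩
  rw [hpc] at h2
  have h3 := congrArg Subtype.val h2
  intro i
  exact (congrFun h3 i).symm

end Existence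

/-! ### Linear forms restricting to the monomials on the curve -/

section VeroneseForms

variable {K : Type*} [Field K] {n r : ℕ}

lemma isHomogeneous_veroneseForms (φ : (Fin (r + 1) → K) →ₗ[K] (Fin (n + 1) → K))
    (i : Fin (n + 1)) : (veroneseForms φ i).IsHomogeneous r := by
  refine IsHomogeneous.sum _ _ _ fun j _ => IsHomogeneous.C_mul ?_ _
  convert isHomogeneous_X_pow_mul_X_pow (K := K) (r - j) j using 1
  omega

lemma exists_aeval_veroneseForms_eq {φ : (Fin (r + 1) → K) →ₗ[K] (Fin (n + 1) → K)}
    (hφ : Function.Injective φ) : ∃ ℓ : ℕ → CoordRing K n, (∀ j, (ℓ j).IsHomogeneous 1) ∧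
      ∀ j ≤ r, aeval (veroneseForms φ) (ℓ j) = X 0 ^ (r - j) * X 1 ^ j := by
  obtain ⟨ρ, hρ⟩ := φ.exists_leftInverse_of_injective (LinearMap.ker_eq_bot.2 hφ)
  have key : ∀ j : Fin (r + 1), ∃ l : CoordRing K n, l.IsHomogeneous 1 ∧
      aeval (veroneseForms φ) l = X 0 ^ (r - (j : ℕ)) * X 1 ^ (j : ℕ) := by
    intro j
    -- The coefficients are row `j` of a left inverse of `φ`.
    refine ⟨∑ i, ρ (Pi.single i 1) j • X i, ?_, ?_⟩
    · exact Submodule.sum_mem (homogeneousSubmodule _ K 1) fun i _ =>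
        Submodule.smul_mem _ _ (isHomogeneous_X _ _)
    · have h1 : ∀ k, ∑ i, ρ (Pi.single i 1) j * φ (Pi.single k 1) i
          = (Pi.single j 1 : Fin (r + 1) → K) k := by
        intro k
        have h2 : LinearMap.toMatrix' ρ * LinearMap.toMatrix' φ = 1 := by
          rw [← LinearMap.toMatrix'_comp, hρ, LinearMap.toMatrix'_id]
        have h3 := congrFun (congrFun h2 j) k
        rw [Matrix.mul_apply, Matrix.one_eq_pi_single] at h3
        exact h3
      have h2 : ∀ i, veroneseForms φ i = binaryForm r fun k => φ (Pi.single k 1) i := by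
        intro i
        simp only [veroneseForms, binaryForm, Fintype.linearCombination_apply,
          MvPolynomial.smul_eq_C_mul]
      rw [map_sum, ← binaryForm_single r j j.2]
      simp only [map_smul, aeval_X, h2]
      simp only [← map_smul]
      rw [← map_sum]
      congr 1
      funext k
      simp only [Finset.sum_apply, Pi.smul_apply, smul_eq_mul]
      exact h1 k
  refine ⟨fun j => if h : j < r + 1 then (key ⟨j, h⟩).choose else 0, fun j => ?_, fun j hj => ?_⟩
  · dsimp only
    split_ifs with h
    · exact (key ⟨j, h⟩).choose_spec.1
    · exact isHomogeneous_zero _ _ _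
  · have h : j < r + 1 := by omega
    simp only [h, dif_pos]
    exact (key ⟨j, h⟩).choose_spec.2

end VeroneseForms

theorem mainTheorem5 {K : Type*} [Field K] [IsAlgClosed K] [CharZero K] (r : ℕ) (hr : 2 ≤ r)
    (C : ClosedSubschemeP K (2 * r - 1)) (hC : IsRationalNormalCurve r C) :
    (∃ X : ClosedSubschemeP K (2 * r - 1),
      IsDoubleStructure C X ∧ X.IsNondegenerate ∧ X.HasArithmeticGenus 1) ∧
    ∀ X Y : ClosedSubschemeP K (2 * r - 1),
      IsDoubleStructure C X → X.IsNondegenerate → X.HasArithmeticGenus 1 →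
      IsDoubleStructure C Y → Y.IsNondegenerate → Y.HasArithmeticGenus 1 →
      ProjectivelyEquivalent X Y := by
  obtain ⟨m, rfl⟩ := Nat.exists_eq_add_of_le' hr
  obtain ⟨φ, hφ, hCφ⟩ := hC
  have hn : 2 * (m + 2) - 1 + 1 = 2 * (m + 2) := by omega
  have hF := isHomogeneous_veroneseForms φ
  have hCF : ∀ f, f ∈ C.ideal ↔ aeval (veroneseForms φ) f = 0 := fun f => by
    rw [hCφ, RingHom.mem_ker]
  obtain ⟨ℓ, hℓ1, hℓ⟩ := exists_aeval_veroneseForms_eq hφ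
  refine ⟨?_, fun X Y hX hX' hX'' hY hY' hY'' => ?_⟩
  · obtain ⟨G, hG⟩ := exists_isDoubledParametrization hn hF hℓ hℓ1
    have hF0 := exists_ne_zero_of_aeval_eq hℓ hℓ1
    exact ⟨doubledScheme hG hF0, doubledScheme_isDoubleStructure hG hF0 hn hℓ hℓ1 hCF,
      doubledScheme_isNondegenerate hG hF0, doubledScheme_hasArithmeticGenus hG hF0 hn hℓ hℓ1⟩
  · obtain ⟨G, hG, hXG⟩ := hX.exists_doubledParametrization hF hCF hℓ hℓ1 hX' hX''
    obtain ⟨H, hH, hYH⟩ := hY.exists_doubledParametrization hF hCF hℓ hℓ1 hY' hY''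
    exact projectivelyEquivalent_of_doubledParametrization hn hG hH hXG hYH
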